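/- Let $p$ be a prime, $k$ a field of characteristic $p$, and $r\le n$ non-negative integers. **Monoids.** $\bar\tau_r$ is the monoid (under composition) of all maps $\alpha:\{0,\dots,r\}\to\{0,\dots,r\}$ with $\alpha(0)=0$; $\mathfrak S_r\subseteq\bar\tau_r$ is the symmetric group on $\{1,\dots,r\}$ (extended by $0\mapsto0$); the rook monoid is $\Re_r=\{\alpha\in\bar\tau_r : |\alpha^{-1}(i)|\le 1 \text{ for } 1\le i\le r\}$. Let $S_r$ be a submonoid of $\bar\tau_r$ with $\Re_r\subseteq S_r$. **The algebra $B_R$.** Let $\Lambda$ be the set of compositions $\lambda=(\lambda_1,\dots,\lambda_n)$ of $r$ with $n$ parts $\lambda_i\ge 0$, and $\Lambda^+\subseteq\Lambda$ the set of partitions (weakly decreasing compositions). The $\lambda$-blocks are the consecutive intervals of $\{1,\dots,r\}$ of lengths $\lambda_1,\dots,\lambda_n$, and $G_\lambda\subseteq\mathfrak S_r$ is the Young subgroup of the permutations preserving each $\lambda$-block. For $\alpha\in S_r$ let $D_\alpha=G_\lambda\alpha G_\mu$, and let $n_R(D_\alpha)=n_R(\lambda,\alpha,\mu)$ be the order of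 $\{\sigma\in G_\lambda:\exists\pi\in G_\mu,\ \sigma\alpha=\alpha\pi\}$. The right generalized Schur algebra $B_R$ is the $k$-algebra with basis $f(\lambda,D,\mu)$ ($\lambda,\mu\in\Lambda$, $D\in G_\lambda\backslash S_r/G_\mu$), where $f(\lambda,\alpha,\mu)=f(\lambda,D_\alpha,\mu)$, with product $f(\lambda,\alpha,\nu)f(\omega,\beta,\mu)=0$ if $\nu\ne\omega$ and $$f(\lambda,\alpha,\nu)f(\nu,\beta,\mu)=\sum_{D}\frac{n_R(D)\,\#\{\rho\in G_\nu:\alpha\rho\beta\in D\}}{n_R(\lambda,\alpha,\nu)\,n_R(\nu,\beta,\mu)}\,f(\lambda,D,\mu),$$ the coefficients being integers. **The algebra $C_R^\lambda$.** Put $1_\lambda=f(\lambda,1,\lambda)$. For $\nu\in\Lambda$ and $\lambda\in\Lambda^+$ write $\nu<\lambda$ if the partition obtained by rearranging $\nu$ is lexicographically smaller than $\lambda$, and let $e_\lambda=\sum_{\nu<\lambda}1_\nu$. Put $B_R^\lambda=1_\lambda B_R1_\lambda$ and $C_R^\lambda=B_R^\lambda/(B_Re_\lambda B_R\cap B_R^\lambda)$,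 with projection $\Pi_R:B_R^\lambda\to C_R^\lambda$. **The submonoid $S'$.** Let $\lambda\in\Lambda^+$ be a $p$-partition, that is, every non-zero part is a power $p^i$ ($i\ge0$), and let $s_i$ be the number of parts equal to $p^i$. Fill the Young diagram of $\lambda$ with $1,\dots,r$ row by row. Let $\phi_\lambda:\prod_{s_i>0}\bar\tau_{s_i}\to\bar\tau_r$ be the injective homomorphism for which $\phi_\lambda((\alpha_i)_i)$ maps the $b$-th entry of the $a$-th row of length $p^i$ to the $b$-th entry of the $\alpha_i(a)$-th row of length $p^i$ if $\alpha_i(a)\neq0$, and to $0$ if $\alpha_i(a)=0$. (For $s_i=0$ the factors $\bar\tau_{s_i}$, $\mathfrak S_{s_i}$ are read as trivial.) Let $S_r^\lambda=\operatorname{im}(\phi_\lambda)\cap S_r$, let $\psi_{\lambda,R}:k[S_r^\lambda]\to B_R^\lambda$ be the $k$-linear map $\alpha\mapsto f(\lambda,\alpha,\lambda)$, and let $$S'=\phi_\lambda\Big(\bar\tau_{s_0}\cdot\prod_{i>0}\mathfrak S_{s_i}\Big)\cap S_r^\lambda .$$ **Proposition 8.4.** The map $\Pi_R\circ\psi_{\lambda,R}$,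 restricted to $k[S']$, is an isomorphism of $k$-algebras $k[S']\to C_R^\lambda$. Moreover there is a submonoid $S_0$ with $\Re_{s_0}\subseteq S_0\subseteq\bar\tau_{s_0}$ such that $S'=\phi_\lambda\big(S_0\cdot\prod_{i>0}\mathfrak S_{s_i}\big)$, and there are isomorphisms of $k$-algebras $$C_R^\lambda\;\cong\;k[S']\;\cong\;k\Big[S_0\cdot\prod_{i>0}\mathfrak S_{s_i}\Big]\;\cong\;k[S_0]\otimes_k\Big(\bigotimes_{i>0,\ s_i>0}k[\mathfrak S_{s_i}]\Big).$$ -/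

import Mathlib

open scoped TensorProduct

namespace GenSchur

/-! ## Transformation monoids -/

/-- The maps `α : {0,…,r} → {0,…,r}` with `α 0 = 0`, as a submonoid of all self-maps of
`{0,…,r}` under composition. -/
def ptSub (r : ℕ) : Submonoid (Function.End (Fin (r + 1))) where
  carrier := {α | α 0 = 0}
  one_mem' := rfl
  mul_mem' := by
    intro a b ha hb
    change a (b 0) = 0
    rw [show b 0 = 0 from hb]
    exact ha

/-- The monoid `τ̄_r` of all maps `α : {0,…,r} → {0,…,r}` with `α 0 = 0`, under composition. -/
abbrev PT (r : ℕ) : Type := ptSub r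

/-- `α x` for `α ∈ τ̄_r`. -/
def PT.app {r : ℕ} (α : PT r) (x : Fin (r + 1)) : Fin (r + 1) := α.1 x

@[simp] theorem PT.app_zero {r : ℕ} (α : PT r) : α.app 0 = 0 := α.2

@[simp] theorem PT.one_app {r : ℕ} (x : Fin (r + 1)) : (1 : PT r).app x = x := rfl

@[simp] theorem PT.mul_app {r : ℕ} (α β : PT r) (x : Fin (r + 1)) :
    (α * β).app x = α.app (β.app x) := rfl

theorem PT.ext {r : ℕ} {α β : PT r} (h : ∀ x, α.app x = β.app x) : α = β :=
  Subtype.ext (funext h)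

/-- Build `α ∈ τ̄_r` from its values on `1,…,r`. -/
def PT.mk {r : ℕ} (f : Fin r → Fin (r + 1)) : PT r :=
  ⟨fun x => Fin.cases (motive := fun _ => Fin (r + 1)) 0 f x, Eq.refl (0 : Fin (r + 1))⟩

@[simp] theorem PT.mk_app_succ {r : ℕ} (f : Fin r → Fin (r + 1)) (x : Fin r) :
    (PT.mk f).app x.succ = f x := rfl

/-- The inclusion `𝔖_r → τ̄_r`; the point `x : Fin r` stands for the element `x + 1`
of `{1,…,r}`. -/
def permHom (r : ℕ) : Equiv.Perm (Fin r) →* PT r where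
  toFun σ := PT.mk fun x => (σ x).succ
  map_one' := by
    refine PT.ext fun x => ?_
    refine Fin.cases ?_ (fun y => ?_) x <;> simp
  map_mul' σ τ := by
    refine PT.ext fun x => ?_
    refine Fin.cases ?_ (fun y => ?_) x <;> simp

/-- The symmetric group `𝔖_r` as a submonoid of `τ̄_r`. -/
def symSub (r : ℕ) : Submonoid (PT r) := MonoidHom.mrange (permHom r)

/-- The rook monoid `ℜ_r`: every `i ≠ 0` has at most one preimage. -/
def rook (r : ℕ) : Submonoid (PT r) where
  carrier := {α | ∀ i, i ≠ 0 → ∀ x y, α.app x = i → α.app y = i → x = y}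
  one_mem' := by
    intro i _ x y hx hy
    exact hx.trans hy.symm
  mul_mem' := by
    intro a b ha hb i hi x y hx hy
    have hxy : b.app x = b.app y := ha i hi _ _ hx hy
    refine hb (b.app x) (fun h0 => hi ?_) x y rfl hxy.symm
    rw [← hx, PT.mul_app, h0, PT.app_zero]

/-- A monoid `S_r` with `𝔖_r ⊆ S_r ⊆ τ̄_r`. -/
structure TransMonoid (r : ℕ) where
  toSubmonoid : Submonoid (PT r)
  sym_le : symSub r ≤ toSubmonoid

/-- The elements of `S_r`. -/
abbrev TransMonoid.Elt {r : ℕ} (S : TransMonoid r) : Type := S.toSubmonoid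

/-- The inclusion `𝔖_r → S_r`. -/
def TransMonoid.perm {r : ℕ} (S : TransMonoid r) : Equiv.Perm (Fin r) →* S.Elt :=
  (permHom r).codRestrict S.toSubmonoid fun σ => S.sym_le ⟨σ, rfl⟩

/-! ## Compositions, blocks, Young subgroups -/

/-- `Λ(r,n)`: compositions of `r` with `n` parts (zero parts are allowed). -/
def Comp (r n : ℕ) : Type := {l : Fin n → ℕ // ∑ i, l i = r}

instance (r n : ℕ) : Finite (Comp r n) := by
  let F : Comp r n → (Fin n → Fin (r + 1)) := fun l i =>
    ⟨l.1 i, Nat.lt_succ_of_le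
      ((Finset.single_le_sum (fun _ _ => Nat.zero_le _) (Finset.mem_univ i)).trans l.2.le)⟩
  refine Finite.of_injective F fun a b h => Subtype.ext (funext fun i => ?_)
  exact congrArg Fin.val (congrFun h i)

noncomputable instance (r n : ℕ) : Fintype (Comp r n) := Fintype.ofFinite _

noncomputable instance (r n : ℕ) : DecidableEq (Comp r n) := Classical.decEq _

/-- The bijection sending `(j, b)` to the `b`-th element of the `j`-th block, where the blocks
are consecutive intervals of lengths `λ_1, …, λ_n` (all indices start at `0`): the image of
`(j, b)` is `λ_1 + ⋯ + λ_{j-1} + b`. -/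
def cell {r n : ℕ} (l : Comp r n) : (Σ j : Fin n, Fin (l.1 j)) ≃ Fin r :=
  finSigmaFinEquiv.trans (finCongr l.2)

/-- The index of the `λ`-block containing `x`. -/
def row {r n : ℕ} (l : Comp r n) (x : Fin r) : Fin n := ((cell l).symm x).1

/-- The Young subgroup `𝔖_λ = G_λ`: the permutations which map every `λ`-block to itself. -/
def young {r n : ℕ} (l : Comp r n) : Subgroup (Equiv.Perm (Fin r)) where
  carrier := {σ | ∀ x, row l (σ x) = row l x}
  one_mem' := fun _ => rfl
  mul_mem' := fun {a b} ha hb x => (ha (b x)).trans (hb x)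
  inv_mem' := fun {a} ha x => by
    have h := ha (a⁻¹ x)
    rw [← Equiv.Perm.mul_apply, mul_inv_cancel, Equiv.Perm.one_apply] at h
    exact h.symm

noncomputable instance {r n : ℕ} (l : Comp r n) : Fintype (young l) := Fintype.ofFinite _

/-- `L(λ,k)`: the number of rows of length `k`. -/
def numRows {r n : ℕ} (l : Comp r n) (k : ℕ) : ℕ :=
  (Finset.univ.filter fun i => l.1 i = k).card

/-- Partitions: weakly decreasing compositions. -/
def IsPartition {r n : ℕ} (l : Comp r n) : Prop := Antitone l.1

/-- `λ ∼ μ`: the same number of rows of each length. -/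
def Equi {r n : ℕ} (l m : Comp r n) : Prop := ∀ k, numRows l k = numRows m k

/-- The lexicographic order, used for partitions. -/
def lexLT {r n : ℕ} (l m : Comp r n) : Prop := ∃ k, (∀ i, i < k → l.1 i = m.1 i) ∧ l.1 k < m.1 k

/-- `ν < λ` for compositions: the partition rearranging `ν` is lexicographically smaller than the
partition rearranging `λ`. -/
def compLT {r n : ℕ} (v l : Comp r n) : Prop :=
  ∃ v' l' : Comp r n, IsPartition v' ∧ Equi v v' ∧ IsPartition l' ∧ Equi l l' ∧ lexLT v' l'

/-! ## Double cosets and structure constants -/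

section DoubleCosets

variable {r n : ℕ} (S : TransMonoid r)

/-- `α` and `β` lie in the same double coset: `β = σ α π` with `σ ∈ G_λ`, `π ∈ G_μ`. -/
def dcSetoid (l m : Comp r n) : Setoid S.Elt where
  r α β := ∃ σ ∈ young l, ∃ π ∈ young m, S.perm σ * α * S.perm π = β
  iseqv :=
    { refl := fun α => ⟨1, one_mem _, 1, one_mem _, by simp⟩
      symm := by
        rintro α β ⟨σ, hσ, π, hπ, rfl⟩
        refine ⟨σ⁻¹, inv_mem hσ, π⁻¹, inv_mem hπ, ?_⟩
        simp only [mul_assoc, ← map_mul, mul_inv_cancel, map_one, mul_one]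
        simp only [← mul_assoc, ← map_mul, inv_mul_cancel, map_one, one_mul]
      trans := by
        rintro α β γ ⟨σ, hσ, π, hπ, rfl⟩ ⟨σ', hσ', π', hπ', rfl⟩
        refine ⟨σ' * σ, mul_mem hσ' hσ, π * π', mul_mem hπ hπ', ?_⟩
        simp only [map_mul, mul_assoc] }

/-- `_λM_μ`: the set of double cosets `G_λ α G_μ`, `α ∈ S_r`. -/
def DC (l m : Comp r n) : Type := Quotient (dcSetoid S l m)

/-- The double coset `D(λ,α,μ) = G_λ α G_μ`. -/
def dc (l m : Comp r n) (α : S.Elt) : DC S l m := Quotient.mk (dcSetoid S l m) α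

instance (l m : Comp r n) : Finite (DC S l m) := by
  have : Finite S.Elt := by
    have : Finite (Function.End (Fin (r + 1))) :=
      inferInstanceAs (Finite (Fin (r + 1) → Fin (r + 1)))
    infer_instance
  exact inferInstanceAs (Finite (Quotient (dcSetoid S l m)))

noncomputable instance (l m : Comp r n) : Fintype (DC S l m) := Fintype.ofFinite _

noncomputable instance (l m : Comp r n) : DecidableEq (DC S l m) := Classical.decEq _

variable {S}

theorem dc_eq_iff {l m : Comp r n} {α β : S.Elt} :
    dc S l m α = dc S l m β ↔ ∃ σ ∈ young l, ∃ π ∈ young m, S.perm σ * α * S.perm π = β :=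
  Quotient.eq (r := dcSetoid S l m)

theorem dc_mul_left {l m : Comp r n} (α : S.Elt) {σ : Equiv.Perm (Fin r)} (hσ : σ ∈ young l) :
    dc S l m (S.perm σ * α) = dc S l m α :=
  (dc_eq_iff.2 ⟨σ, hσ, 1, one_mem _, by simp⟩).symm

theorem dc_mul_right {l m : Comp r n} (α : S.Elt) {π : Equiv.Perm (Fin r)} (hπ : π ∈ young m) :
    dc S l m (α * S.perm π) = dc S l m α :=
  (dc_eq_iff.2 ⟨1, one_mem _, π, hπ, by simp⟩).symm

theorem DC.ind {l m : Comp r n} {P : DC S l m → Prop} (h : ∀ α, P (dc S l m α)) (D) : P D :=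
  Quotient.ind h D

/-- The group `G_R(λ,α,μ)` of all `σ ∈ G_λ` with `σ α = α π` for some `π ∈ G_μ`. -/
def GR (l m : Comp r n) (α : S.Elt) : Subgroup (Equiv.Perm (Fin r)) where
  carrier := {σ | σ ∈ young l ∧ ∃ π ∈ young m, S.perm σ * α = α * S.perm π}
  one_mem' := ⟨one_mem _, 1, one_mem _, by simp⟩
  mul_mem' := by
    rintro a b ⟨ha, π, hπ, h⟩ ⟨hb, ρ, hρ, h'⟩
    exact ⟨mul_mem ha hb, π * ρ, mul_mem hπ hρ, by
      rw [map_mul, mul_assoc, h', ← mul_assoc, h, mul_assoc, map_mul]⟩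
  inv_mem' := by
    rintro a ⟨ha, π, hπ, h⟩
    refine ⟨inv_mem ha, π⁻¹, inv_mem hπ, ?_⟩
    calc S.perm a⁻¹ * α = S.perm a⁻¹ * (α * S.perm π) * S.perm π⁻¹ := by
          simp only [mul_assoc, ← map_mul, mul_inv_cancel, map_one, mul_one]
      _ = α * S.perm π⁻¹ := by
          rw [← h]
          simp only [← mul_assoc, ← map_mul, inv_mul_cancel, map_one, one_mul]

theorem card_GR_congr (l m : Comp r n) {α β : S.Elt} (h : dc S l m α = dc S l m β) :
    Nat.card (GR l m α) = Nat.card (GR l m β) := by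
  obtain ⟨σ, hσ, π, hπ, rfl⟩ := dc_eq_iff.1 h
  refine Nat.card_congr ((MulAut.conj σ).toEquiv.subtypeEquiv fun τ => ?_)
  change (τ ∈ young l ∧ _) ↔ (σ * τ * σ⁻¹ ∈ young l ∧ _)
  refine and_congr ?_ ?_
  · rw [Subgroup.mul_mem_cancel_right _ (inv_mem hσ), Subgroup.mul_mem_cancel_left _ hσ]
  · constructor
    · rintro ⟨ρ, hρ, e⟩
      refine ⟨π⁻¹ * ρ * π, mul_mem (mul_mem (inv_mem hπ) hρ) hπ, ?_⟩
      calc S.perm (σ * τ * σ⁻¹) * (S.perm σ * α * S.perm π)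
          = S.perm σ * (S.perm τ * α) * S.perm π := by
            rw [← mul_assoc, ← mul_assoc, ← map_mul, inv_mul_cancel_right, map_mul,
              mul_assoc (S.perm σ)]
        _ = S.perm σ * α * S.perm π * S.perm (π⁻¹ * ρ * π) := by
            rw [e, mul_assoc _ (S.perm π), ← map_mul, mul_assoc π⁻¹, mul_inv_cancel_left, map_mul]
            simp only [mul_assoc]
    · rintro ⟨ρ, hρ, e⟩
      change S.perm (σ * τ * σ⁻¹) * _ = _ at e
      refine ⟨π * ρ * π⁻¹, mul_mem (mul_mem hπ hρ) (inv_mem hπ), ?_⟩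
      calc S.perm τ * α
          = S.perm σ⁻¹ * (S.perm (σ * τ * σ⁻¹) * (S.perm σ * α * S.perm π)) * S.perm π⁻¹ := by
            simp only [← mul_assoc, ← map_mul, inv_mul_cancel_right, inv_mul_cancel, one_mul]
            simp only [mul_assoc, ← map_mul, mul_inv_cancel, map_one, mul_one]
        _ = α * S.perm (π * ρ * π⁻¹) := by
            rw [e]
            simp only [← mul_assoc, ← map_mul, inv_mul_cancel, map_one, one_mul]
            simp only [mul_assoc, ← map_mul]

/-- `n_R(D)`: the order of `G_R(λ,α,μ)` for any `α ∈ D`. -/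
noncomputable def nR {l m : Comp r n} (D : DC S l m) : ℕ :=
  Quotient.lift (s := dcSetoid S l m) (fun α => Nat.card (GR l m α))
    (fun _ _ h => card_GR_congr l m (Quotient.sound h)) D

theorem nR_dc (l m : Comp r n) (α : S.Elt) : nR (dc S l m α) = Nat.card (GR l m α) := rfl

theorem nR_pos {l m : Comp r n} (D : DC S l m) : 0 < nR D := by
  induction D using DC.ind with
  | h α => rw [nR_dc]; exact Nat.card_pos

theorem card_N_congr {l v m : Comp r n} (D : DC S l m) {α α' β β' : S.Elt}
    (hα : dc S l v α = dc S l v α') (hβ : dc S v m β = dc S v m β') :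
    Nat.card {ρ : young v // dc S l m (α * S.perm ρ * β) = D} =
      Nat.card {ρ : young v // dc S l m (α' * S.perm ρ * β') = D} := by
  obtain ⟨σ, hσ, π, hπ, rfl⟩ := dc_eq_iff.1 hα
  obtain ⟨σ', hσ', π', hπ', rfl⟩ := dc_eq_iff.1 hβ
  refine Nat.card_congr (Equiv.subtypeEquiv
    ((Equiv.mulLeft (⟨π, hπ⟩ : young v)⁻¹).trans (Equiv.mulRight (⟨σ', hσ'⟩ : young v)⁻¹))
    fun ρ => ?_)
  have : S.perm σ * α * S.perm π *
      S.perm (((⟨π, hπ⟩ : young v)⁻¹ * ρ * (⟨σ', hσ'⟩ : young v)⁻¹ : young v) :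
        Equiv.Perm (Fin r)) * (S.perm σ' * β * S.perm π') =
      S.perm σ * ((α * S.perm ρ * β) * S.perm π') := by
    simp only [Subgroup.coe_mul, Subgroup.coe_inv]
    have e : S.perm π * S.perm (π⁻¹ * (ρ : Equiv.Perm (Fin r)) * σ'⁻¹) * S.perm σ' =
        S.perm ρ := by
      rw [← map_mul, ← map_mul]
      congr 1
      group
    calc _ = S.perm σ * (α * (S.perm π * S.perm (π⁻¹ * (ρ : Equiv.Perm (Fin r)) * σ'⁻¹) *
          S.perm σ') * β * S.perm π') := by simp only [mul_assoc]
      _ = _ := by rw [e]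
  change _ ↔ dc S l m (_ * S.perm (((⟨π, hπ⟩ : young v)⁻¹ * ρ * (⟨σ', hσ'⟩ : young v)⁻¹ :
    young v) : Equiv.Perm (Fin r)) * _) = D
  rw [this, dc_mul_left _ hσ, dc_mul_right _ hπ']

/-- `N(D_α, D_β, D)`: the number of `ρ ∈ G_ν` with `α ρ β ∈ D`. -/
noncomputable def numN {l v m : Comp r n} (D₁ : DC S l v) (D₂ : DC S v m) (D : DC S l m) : ℕ :=
  Quotient.lift₂ (s₁ := dcSetoid S l v) (s₂ := dcSetoid S v m)
    (fun α β => Nat.card {ρ : young v // dc S l m (α * S.perm ρ * β) = D})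
    (fun _ _ _ _ h h' => card_N_congr D (Quotient.sound h) (Quotient.sound h')) D₁ D₂

theorem numN_dc {l v m : Comp r n} (α β : S.Elt) (D : DC S l m) :
    numN (dc S l v α) (dc S v m β) D =
      Nat.card {ρ : young v // dc S l m (α * S.perm ρ * β) = D} := rfl

/-- The structure constant `n_R(D) N(D₁,D₂,D) / (n_R(D₁) n_R(D₂))`; the division is exact
(`structConst_spec`). -/
noncomputable def structConst {l v m : Comp r n}
    (D₁ : DC S l v) (D₂ : DC S v m) (D : DC S l m) : ℕ :=
  nR D * numN D₁ D₂ D / (nR D₁ * nR D₂)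

theorem card_dvd_sum {G : Type*} [Group G] [Fintype G] (H : Subgroup G) (q : ℕ) (F : G → ℕ)
    (hF : ∀ g, ∀ h ∈ H, F (g * h) = F g) (hq : ∀ g, q ∣ F g) :
    Nat.card H * q ∣ ∑ g, F g := by
  classical
  have : ∑ g, F g = ∑ x : G ⧸ H, Nat.card H * F x.out := by
    rw [← Finset.sum_fiberwise Finset.univ (fun g : G => (g : G ⧸ H)) F]
    refine Finset.sum_congr rfl fun x _ => ?_
    have h1 : ∀ g ∈ Finset.univ.filter (fun g : G => (g : G ⧸ H) = x), F g = F x.out := by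
      intro g hg
      have hg' : (g : G ⧸ H) = x := (Finset.mem_filter.1 hg).2
      have h2 : ((x.out : G) : G ⧸ H) = (g : G ⧸ H) := by rw [hg']; exact Quotient.out_eq' x
      have h3 := hF x.out _ (QuotientGroup.eq.1 h2)
      rwa [mul_inv_cancel_left] at h3
    rw [Finset.sum_congr rfl h1, Finset.sum_const, smul_eq_mul]
    congr 1
    rw [← Fintype.card_subtype, ← Nat.card_eq_fintype_card]
    refine Nat.card_congr ?_
    refine Equiv.subtypeEquiv (Equiv.mulLeft (x.out : G)⁻¹) fun g => ?_
    change (g : G ⧸ H) = x ↔ (x.out : G)⁻¹ * g ∈ H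
    rw [← QuotientGroup.eq, show ((x.out : G) : G ⧸ H) = x from Quotient.out_eq' x]
    exact eq_comm
  rw [this]
  exact Finset.dvd_sum fun x _ => mul_dvd_mul_left _ (hq _)

theorem nat_card_subgroupOf {G : Type*} [Group G] {H K : Subgroup G} (h : H ≤ K) :
    Nat.card (H.subgroupOf K) = Nat.card H :=
  Nat.card_congr (Subgroup.subgroupOfEquivOfLe h).toEquiv

theorem GR_le (l m : Comp r n) (α : S.Elt) : GR l m α ≤ young l := fun _ h => h.1

theorem structConst_dvd {l v m : Comp r n} (D₁ : DC S l v) (D₂ : DC S v m) (D : DC S l m) :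
    nR D₁ * nR D₂ ∣ nR D * numN D₁ D₂ D := by
  classical
  induction D₁ using DC.ind with
  | h α =>
  induction D₂ using DC.ind with
  | h β =>
  induction D using DC.ind with
  | h γ =>
  let P : young l → young v → Prop := fun σ ρ =>
    ∃ π ∈ young m, S.perm σ * (α * S.perm ρ * β) = γ * S.perm π
  let F : young l → ℕ := fun σ => ∑ ρ : young v, if P σ ρ then 1 else 0
  have hA : nR (dc S l m γ) * numN (dc S l v α) (dc S v m β) (dc S l m γ) = ∑ σ, F σ := by
    have h1 : ∀ ρ : young v, (∑ σ : young l, if P σ ρ then 1 else 0) =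
        if dc S l m (α * S.perm ρ * β) = dc S l m γ then nR (dc S l m γ) else 0 := by
      intro ρ
      simp only [P]
      generalize α * S.perm ρ * β = δ
      split_ifs with h
      · rw [← h, nR_dc, ← Finset.card_filter, ← Fintype.card_subtype,
          ← Nat.card_eq_fintype_card, ← nat_card_subgroupOf (GR_le l m δ)]
        obtain ⟨σ₀, hσ₀, π₀, hπ₀, e⟩ := dc_eq_iff.1 h
        refine Nat.card_congr
          ((Equiv.mulLeft (⟨σ₀, hσ₀⟩ : young l)⁻¹).subtypeEquiv fun σ => ?_)
        change (∃ π ∈ young m, S.perm (σ : Equiv.Perm (Fin r)) * δ = γ * S.perm π) ↔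
          (σ₀⁻¹ * (σ : Equiv.Perm (Fin r)) ∈ young l ∧ ∃ π ∈ young m,
            S.perm (σ₀⁻¹ * (σ : Equiv.Perm (Fin r))) * δ = δ * S.perm π)
        rw [and_iff_right (mul_mem (inv_mem hσ₀) σ.2)]
        constructor
        · rintro ⟨π, hπ, e'⟩
          refine ⟨π₀ * π, mul_mem hπ₀ hπ, ?_⟩
          rw [map_mul, mul_assoc, e', ← e, map_mul]
          simp only [← mul_assoc, ← map_mul, inv_mul_cancel, map_one, one_mul]
          simp only [mul_assoc, map_mul]
        · rintro ⟨π, hπ, e'⟩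
          refine ⟨π₀⁻¹ * π, mul_mem (inv_mem hπ₀) hπ, ?_⟩
          calc S.perm σ * δ = S.perm σ₀ * (S.perm (σ₀⁻¹ * σ) * δ) := by
                rw [← mul_assoc, ← map_mul, mul_inv_cancel_left]
            _ = γ * S.perm (π₀⁻¹ * π) := by
                rw [e', ← e]
                simp only [mul_assoc, ← map_mul, mul_inv_cancel_left]
      · refine Finset.sum_eq_zero fun σ _ => if_neg ?_
        rintro ⟨π, hπ, e'⟩
        exact h (by rw [← dc_mul_left _ σ.2, e', dc_mul_right _ hπ])
    rw [Finset.sum_comm, Finset.sum_congr rfl fun ρ _ => h1 ρ, ← Finset.sum_filter,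
      Finset.sum_const, smul_eq_mul, mul_comm, numN_dc, Nat.card_eq_fintype_card,
      Fintype.card_subtype]
  rw [hA, nR_dc, nR_dc, ← nat_card_subgroupOf (GR_le l v α)]
  refine card_dvd_sum _ _ F ?_ ?_
  · rintro σ τ ⟨hτ, π₀, hπ₀, e⟩
    refine Fintype.sum_equiv (Equiv.mulLeft (⟨π₀, hπ₀⟩ : young v)) _ _ fun ρ => ?_
    have : S.perm ((σ * τ : young l) : Equiv.Perm (Fin r)) * (α * S.perm ρ * β) =
        S.perm σ * (α * S.perm (((⟨π₀, hπ₀⟩ : young v) * ρ : young v) :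
          Equiv.Perm (Fin r)) * β) := by
      have e' : S.perm (τ : Equiv.Perm (Fin r)) * α = α * S.perm π₀ := e
      rw [Subgroup.coe_mul, Subgroup.coe_mul, map_mul, map_mul]
      calc _ = S.perm σ * ((S.perm (τ : Equiv.Perm (Fin r)) * α) * S.perm ρ * β) := by
            simp only [mul_assoc]
        _ = _ := by
            rw [e']
            simp only [mul_assoc]
    refine if_congr ?_ rfl rfl
    simp only [P, this, Equiv.coe_mulLeft]
  · intro σ
    rw [← nat_card_subgroupOf (GR_le v m β), ← mul_one (Nat.card _)]
    refine card_dvd_sum _ _ _ ?_ fun _ => one_dvd _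
    rintro ρ κ ⟨hκ, π₀, hπ₀, e⟩
    have e' : S.perm (κ : Equiv.Perm (Fin r)) * β = β * S.perm π₀ := e
    have : S.perm σ * (α * S.perm ((ρ * κ : young v) : Equiv.Perm (Fin r)) * β) =
        S.perm σ * (α * S.perm ρ * β) * S.perm π₀ := by
      rw [Subgroup.coe_mul, map_mul, mul_assoc α, mul_assoc (S.perm _) _ β, e']
      simp only [mul_assoc]
    refine if_congr ?_ rfl rfl
    simp only [P, this]
    constructor
    · rintro ⟨π, hπ, h⟩
      refine ⟨π * π₀⁻¹, mul_mem hπ (inv_mem hπ₀), ?_⟩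
      rw [map_mul, ← mul_assoc γ, ← h]
      simp only [mul_assoc, ← map_mul, mul_inv_cancel, map_one, mul_one]
    · rintro ⟨π, hπ, h⟩
      exact ⟨π * π₀, mul_mem hπ hπ₀, by rw [h, map_mul, mul_assoc]⟩

theorem structConst_spec {l v m : Comp r n} (D₁ : DC S l v) (D₂ : DC S v m) (D : DC S l m) :
    structConst D₁ D₂ D * (nR D₁ * nR D₂) = nR D * numN D₁ D₂ D :=
  Nat.div_mul_cancel (structConst_dvd D₁ D₂ D)

theorem sum_numN {l v m : Comp r n} (α β : S.Elt) (g : DC S l m → ℕ) :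
    ∑ D, numN (dc S l v α) (dc S v m β) D * g D =
      ∑ ρ : young v, g (dc S l m (α * S.perm ρ * β)) := by
  classical
  rw [← Finset.sum_fiberwise Finset.univ
    (fun ρ : young v => dc S l m (α * S.perm ρ * β))]
  refine Finset.sum_congr rfl fun D _ => ?_
  rw [Finset.sum_congr rfl (g := fun _ => g D) fun ρ hρ => by rw [(Finset.mem_filter.1 hρ).2],
    Finset.sum_const, smul_eq_mul, numN_dc, Nat.card_eq_fintype_card, Fintype.card_subtype]

theorem structConst_assoc {l v w m : Comp r n}
    (D₁ : DC S l v) (D₂ : DC S v w) (D₃ : DC S w m) (E : DC S l m) :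
    ∑ D, structConst D₁ D₂ D * structConst D D₃ E =
      ∑ D, structConst D₂ D₃ D * structConst D₁ D E := by
  have hpos : 0 < nR D₁ * nR D₂ * nR D₃ :=
    Nat.mul_pos (Nat.mul_pos (nR_pos _) (nR_pos _)) (nR_pos _)
  refine Nat.eq_of_mul_eq_mul_right hpos ?_
  have hL : (∑ D, structConst D₁ D₂ D * structConst D D₃ E) * (nR D₁ * nR D₂ * nR D₃) =
      nR E * ∑ D, numN D₁ D₂ D * numN D D₃ E := by
    rw [Finset.sum_mul, Finset.mul_sum]
    refine Finset.sum_congr rfl fun D _ => ?_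
    calc _ = structConst D₁ D₂ D * (nR D₁ * nR D₂) * structConst D D₃ E * nR D₃ := by ring
      _ = numN D₁ D₂ D * (structConst D D₃ E * (nR D * nR D₃)) := by
        rw [structConst_spec]; ring
      _ = _ := by rw [structConst_spec]; ring
  have hR : (∑ D, structConst D₂ D₃ D * structConst D₁ D E) * (nR D₁ * nR D₂ * nR D₃) =
      nR E * ∑ D, numN D₂ D₃ D * numN D₁ D E := by
    rw [Finset.sum_mul, Finset.mul_sum]
    refine Finset.sum_congr rfl fun D _ => ?_
    calc _ = structConst D₂ D₃ D * (nR D₂ * nR D₃) * structConst D₁ D E * nR D₁ := by ring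
      _ = numN D₂ D₃ D * (structConst D₁ D E * (nR D₁ * nR D)) := by
        rw [structConst_spec]; ring
      _ = _ := by rw [structConst_spec]; ring
  rw [hL, hR]
  congr 1
  induction D₁ using DC.ind with
  | h α =>
  induction D₂ using DC.ind with
  | h β =>
  induction D₃ using DC.ind with
  | h γ =>
  have key : ∀ (α β : S.Elt) (a b : Comp r n) (E : DC S a b) (c : Comp r n),
      numN (dc S a c α) (dc S c b β) E =
        ∑ ρ : young c, if dc S a b (α * S.perm ρ * β) = E then 1 else 0 := by
    intro α β a b E c
    rw [numN_dc, Nat.card_eq_fintype_card, Fintype.card_subtype, Finset.card_filter]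
  rw [sum_numN, sum_numN]
  simp only [key]
  rw [Finset.sum_comm]
  simp only [mul_assoc]

theorem one_structConst {l m : Comp r n} (D D' : DC S l m) :
    structConst (dc S l l 1) D D' = if D = D' then 1 else 0 := by
  classical
  induction D using DC.ind with
  | h β =>
  have h1 : nR (dc S l l 1) = Nat.card (young l) := by
    rw [nR_dc]
    congr 2
    ext σ
    exact ⟨fun h => h.1, fun h => ⟨h, σ, h, by simp⟩⟩
  have h2 : numN (dc S l l 1) (dc S l m β) D' =
      if dc S l m β = D' then Nat.card (young l) else 0 := by
    rw [numN_dc]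
    simp only [one_mul, dc_mul_left β (Subtype.property _)]
    split_ifs with h
    · simp [h]
    · simp [h]
  rw [structConst, h1, h2]
  have hp : 0 < Nat.card (young l) := Nat.card_pos
  split_ifs with h
  · rw [← h, mul_comm]
    exact Nat.div_self (Nat.mul_pos hp (nR_pos _))
  · simp

theorem structConst_one {l m : Comp r n} (D D' : DC S l m) :
    structConst D (dc S m m 1) D' = if D = D' then 1 else 0 := by
  classical
  induction D using DC.ind with
  | h β =>
  have h1 : nR (dc S m m 1) = Nat.card (young m) := by
    rw [nR_dc]
    congr 2
    ext σ
    exact ⟨fun h => h.1, fun h => ⟨h, σ, h, by simp⟩⟩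
  have h2 : numN (dc S l m β) (dc S m m 1) D' =
      if dc S l m β = D' then Nat.card (young m) else 0 := by
    rw [numN_dc]
    simp only [mul_one, dc_mul_right β (Subtype.property _)]
    split_ifs with h
    · simp [h]
    · simp [h]
  rw [structConst, h1, h2]
  have hp : 0 < Nat.card (young m) := Nat.card_pos
  split_ifs with h
  · rw [← h]
    exact Nat.div_self (Nat.mul_pos (nR_pos _) hp)
  · simp

end DoubleCosets

/-! ## The right generalized Schur algebra -/

/-- The right generalized Schur algebra `B_R` over `k` of the monoid `S = S_r`: the free module
on the double cosets `D ∈ _λM_μ`, `λ, μ ∈ Λ(r,n)`. An element is the family of its coordinates. -/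
def RSchur (k : Type*) {r : ℕ} (S : TransMonoid r) (n : ℕ) : Type _ :=
  ∀ l m : Comp r n, DC S l m → k

namespace RSchur

@[ext] theorem ext {k : Type*} {r n : ℕ} {S : TransMonoid r} {x y : RSchur k S n}
    (h : ∀ l m D, x l m D = y l m D) : x = y :=
  funext fun l => funext fun m => funext fun D => h l m D

variable {k : Type*} [CommRing k] {r n : ℕ} {S : TransMonoid r}

instance : AddCommGroup (RSchur k S n) :=
  inferInstanceAs (AddCommGroup (∀ l m : Comp r n, DC S l m → k))

instance : Module k (RSchur k S n) :=
  inferInstanceAs (Module k (∀ l m : Comp r n, DC S l m → k))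

@[simp] theorem add_coord (x y : RSchur k S n) (l m : Comp r n) (D : DC S l m) :
    (x + y) l m D = x l m D + y l m D := rfl

@[simp] theorem zero_coord (l m : Comp r n) (D : DC S l m) : (0 : RSchur k S n) l m D = 0 := rfl

@[simp] theorem smul_coord (c : k) (x : RSchur k S n) (l m : Comp r n) (D : DC S l m) :
    (c • x) l m D = c * x l m D := rfl

/-- The basis element `f(λ,α,μ)` attached to the double coset of `α`. -/
noncomputable def f (k : Type*) [CommRing k] {r n : ℕ} (S : TransMonoid r) (l m : Comp r n)
    (α : S.Elt) : RSchur k S n :=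
  Pi.single l (Pi.single m (Pi.single (dc S l m α) 1))

/-- The product `*_R`, extended bilinearly from
`f(λ,D₁,ν) f(ν,D₂,μ) = ∑_D n_R(D) N(D₁,D₂,D) / (n_R(D₁) n_R(D₂)) f(λ,D,μ)`,
while `f(λ,D₁,ν) f(ω,D₂,μ) = 0` for `ν ≠ ω`. -/
noncomputable instance : Mul (RSchur k S n) where
  mul x y := fun l m D => ∑ v : Comp r n, ∑ D₁ : DC S l v, ∑ D₂ : DC S v m,
    x l v D₁ * y v m D₂ * (structConst D₁ D₂ D : k)

/-- The identity `∑_λ f(λ,1,λ)`. -/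
noncomputable instance : One (RSchur k S n) where
  one := ∑ l, f k S l l 1

theorem mul_coord (x y : RSchur k S n) (l m : Comp r n) (D : DC S l m) :
    (x * y) l m D = ∑ v : Comp r n, ∑ D₁ : DC S l v, ∑ D₂ : DC S v m,
      x l v D₁ * y v m D₂ * (structConst D₁ D₂ D : k) := rfl

theorem f_coord (l m : Comp r n) (α : S.Elt) (l' m' : Comp r n) (D : DC S l' m') :
    f k S l m α l' m' D = Pi.single (M := fun l => ∀ m, DC S l m → k) l
      (Pi.single m (Pi.single (dc S l m α) 1)) l' m' D := rfl

theorem sum_coord {ι : Type*} (s : Finset ι) (F : ι → RSchur k S n) (l m : Comp r n)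
    (D : DC S l m) : (∑ i ∈ s, F i) l m D = ∑ i ∈ s, F i l m D :=
  map_sum (⟨⟨fun x => x l m D, rfl⟩, fun _ _ => rfl⟩ : RSchur k S n →+ k) F s

theorem one_coord_same (l : Comp r n) (D : DC S l l) :
    (1 : RSchur k S n) l l D = if dc S l l 1 = D then 1 else 0 := by
  change (∑ l', f k S l' l' 1 : RSchur k S n) l l D = _
  rw [sum_coord, Finset.sum_eq_single l]
  · simp only [f, Pi.single_eq_same, Pi.single_apply]
    exact if_congr eq_comm rfl rfl
  · intro b _ hb
    simp only [f]
    rw [Pi.single_eq_of_ne (Ne.symm hb)]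
    rfl
  · simp

theorem one_coord_ne {l m : Comp r n} (h : l ≠ m) (D : DC S l m) :
    (1 : RSchur k S n) l m D = 0 := by
  change (∑ l', f k S l' l' 1 : RSchur k S n) l m D = _
  rw [sum_coord]
  refine Finset.sum_eq_zero fun b _ => ?_
  simp only [f]
  by_cases hb : l = b
  · subst hb
    rw [Pi.single_eq_same, Pi.single_eq_of_ne (Ne.symm h)]
    rfl
  · rw [Pi.single_eq_of_ne hb]
    rfl

theorem sum_rot {A B C : Type*} [Fintype A] [Fintype B] [Fintype C] (F : A → B → C → k) :
    ∑ a, ∑ b, ∑ c, F a b c = ∑ c, ∑ a, ∑ b, F a b c := by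
  calc ∑ a, ∑ b, ∑ c, F a b c = ∑ a, ∑ c, ∑ b, F a b c :=
        Finset.sum_congr rfl fun a _ => Finset.sum_comm
    _ = ∑ c, ∑ a, ∑ b, F a b c := Finset.sum_comm

protected theorem mul_assoc' (x y z : RSchur k S n) : x * y * z = x * (y * z) := by
  ext l m E
  have hL : (x * y * z) l m E = ∑ w : Comp r n, ∑ v : Comp r n, ∑ D₁ : DC S l v,
      ∑ D₂ : DC S v w, ∑ D₃ : DC S w m, x l v D₁ * y v w D₂ * z w m D₃ *
        ((∑ D, structConst D₁ D₂ D * structConst D D₃ E : ℕ) : k) := by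
    rw [mul_coord]
    refine Finset.sum_congr rfl fun w _ => ?_
    simp only [mul_coord, Finset.sum_mul, Nat.cast_sum, Finset.mul_sum]
    rw [sum_rot]
    refine Finset.sum_congr rfl fun v _ => ?_
    rw [sum_rot]
    refine Finset.sum_congr rfl fun D₁ _ => ?_
    rw [sum_rot]
    refine Finset.sum_congr rfl fun D₂ _ => ?_
    rw [Finset.sum_comm]
    refine Finset.sum_congr rfl fun D₃ _ => Finset.sum_congr rfl fun D _ => ?_
    push_cast
    ring
  have hR : (x * (y * z)) l m E = ∑ w : Comp r n, ∑ v : Comp r n, ∑ D₁ : DC S l v,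
      ∑ D₂ : DC S v w, ∑ D₃ : DC S w m, x l v D₁ * y v w D₂ * z w m D₃ *
        ((∑ D, structConst D₂ D₃ D * structConst D₁ D E : ℕ) : k) := by
    rw [mul_coord, Finset.sum_comm]
    refine Finset.sum_congr rfl fun v _ => ?_
    simp only [mul_coord, Finset.sum_mul, Nat.cast_sum, Finset.mul_sum]
    refine Eq.trans (Finset.sum_congr rfl fun D₁ _ => ?_) Finset.sum_comm
    rw [Finset.sum_comm]
    refine Finset.sum_congr rfl fun w _ => ?_
    rw [Finset.sum_comm]
    refine Finset.sum_congr rfl fun D₂ _ => ?_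
    rw [Finset.sum_comm]
    refine Finset.sum_congr rfl fun D₃ _ => Finset.sum_congr rfl fun D _ => ?_
    push_cast
    ring
  rw [hL, hR]
  simp only [structConst_assoc]

protected theorem one_mul' (x : RSchur k S n) : 1 * x = x := by
  ext l m D
  rw [mul_coord, Finset.sum_eq_single l]
  · simp only [one_coord_same, ite_mul, one_mul, zero_mul]
    rw [Finset.sum_comm]
    simp [one_structConst]
  · intro b _ hb
    simp [one_coord_ne (Ne.symm hb)]
  · simp

protected theorem mul_one' (x : RSchur k S n) : x * 1 = x := by
  ext l m D
  rw [mul_coord, Finset.sum_eq_single m]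
  · simp [one_coord_same, structConst_one]
  · intro b _ hb
    simp [one_coord_ne hb]
  · simp

noncomputable instance : Ring (RSchur k S n) :=
  { (inferInstance : AddCommGroup (RSchur k S n)),
    (inferInstance : Mul (RSchur k S n)),
    (inferInstance : One (RSchur k S n)) with
    left_distrib := fun x y z => by
      ext l m D
      simp only [mul_coord, add_coord, mul_add, add_mul, Finset.sum_add_distrib]
    right_distrib := fun x y z => by
      ext l m D
      simp only [mul_coord, add_coord, add_mul, Finset.sum_add_distrib]
    zero_mul := fun x => by
      ext l m D
      simp [mul_coord]
    mul_zero := fun x => by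
      ext l m D
      simp [mul_coord]
    mul_assoc := RSchur.mul_assoc'
    one_mul := RSchur.one_mul'
    mul_one := RSchur.mul_one' }

noncomputable instance : Algebra k (RSchur k S n) :=
  Algebra.ofModule
    (fun c x y => by
      ext l m D
      simp only [mul_coord, smul_coord, Finset.mul_sum, mul_assoc])
    (fun c x y => by
      ext l m D
      simp only [mul_coord, smul_coord, Finset.mul_sum]
      refine Finset.sum_congr rfl fun _ _ => Finset.sum_congr rfl fun _ _ =>
        Finset.sum_congr rfl fun _ _ => ?_
      ring)

theorem f_mul_coord_same (x : RSchur k S n) (l m : Comp r n) (D : DC S l m) :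
    (f k S l l 1 * x) l m D = x l m D := by
  rw [mul_coord, Finset.sum_eq_single l]
  · simp only [f, Pi.single_eq_same, Pi.single_apply, ite_mul, one_mul, zero_mul]
    rw [Finset.sum_comm]
    simp [one_structConst]
  · intro b _ hb
    simp [f, Pi.single_eq_of_ne hb]
  · simp

theorem f_mul_coord_ne (x : RSchur k S n) {l a : Comp r n} (h : a ≠ l) (m : Comp r n)
    (D : DC S a m) : (f k S l l 1 * x) a m D = 0 := by
  rw [mul_coord]
  simp [f, Pi.single_eq_of_ne h]

theorem mul_f_coord_same (x : RSchur k S n) (l m : Comp r n) (D : DC S l m) :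
    (x * f k S m m 1) l m D = x l m D := by
  rw [mul_coord, Finset.sum_eq_single m]
  · simp [f, Pi.single_apply, structConst_one]
  · intro b _ hb
    simp [f, Pi.single_eq_of_ne hb]
  · simp

theorem mul_f_coord_ne (x : RSchur k S n) {m b : Comp r n} (h : b ≠ m) (l : Comp r n)
    (D : DC S l b) : (x * f k S m m 1) l b D = 0 := by
  rw [mul_coord]
  refine Finset.sum_eq_zero fun v _ => Finset.sum_eq_zero fun D₁ _ =>
    Finset.sum_eq_zero fun D₂ _ => ?_
  by_cases hv : v = m
  · subst hv
    simp [f, Pi.single_eq_of_ne h]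
  · simp [f, Pi.single_eq_of_ne hv]

theorem one_mul_f (l m : Comp r n) (α : S.Elt) : f k S l l 1 * f k S l m α = f k S l m α := by
  ext a b D
  by_cases h : a = l
  · subst h
    rw [f_mul_coord_same]
  · rw [f_mul_coord_ne _ h]
    simp [f, Pi.single_eq_of_ne h]

theorem f_mul_one (l m : Comp r n) (α : S.Elt) : f k S l m α * f k S m m 1 = f k S l m α := by
  ext a b D
  by_cases h : b = m
  · subst h
    rw [mul_f_coord_same]
  · rw [mul_f_coord_ne _ h]
    by_cases ha : a = l
    · subst ha
      simp [f, Pi.single_eq_of_ne h]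
    · simp [f, Pi.single_eq_of_ne ha]

end RSchur

/-! ## The algebras `B_R^λ` and `C_R^λ` -/

section Corner

variable {k A : Type*} [CommRing k] [Ring A] [Algebra k A] {e : A}

theorem smul_mem_corner (c : k) {x : A} (hx : x ∈ Subsemigroup.corner e) :
    c • x ∈ Subsemigroup.corner e := by
  obtain ⟨y, rfl⟩ := hx
  exact ⟨c • y, by simp⟩

instance cornerModule (he : IsIdempotentElem e) : Module k he.Corner where
  smul c x := ⟨c • x.1, smul_mem_corner c x.2⟩
  one_smul x := Subtype.ext (one_smul k x.1)
  mul_smul c d x := Subtype.ext (mul_smul c d x.1)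
  smul_zero c := Subtype.ext (smul_zero c)
  smul_add c x y := Subtype.ext (smul_add c x.1 y.1)
  add_smul c d x := Subtype.ext (add_smul c d x.1)
  zero_smul x := Subtype.ext (zero_smul k x.1)

/-- The `k`-algebra structure on `e A e`, with unit `e`. -/
instance cornerAlgebra (he : IsIdempotentElem e) : Algebra k he.Corner :=
  Algebra.ofModule (fun c x y => Subtype.ext (smul_mul_assoc c x.1 y.1))
    (fun c x y => Subtype.ext (mul_smul_comm c x.1 y.1))

end Corner

section Quotients

variable (k : Type*) [CommRing k] {r n : ℕ} (S : TransMonoid r) (l : Comp r n)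

theorem isIdempotentElem_f : IsIdempotentElem (RSchur.f k S l l 1) := RSchur.one_mul_f l l 1

/-- `B_R^λ = 1_λ B_R 1_λ`, a `k`-algebra with unit `1_λ = f(λ,1,λ)`. -/
abbrev BCorner : Type _ := (isIdempotentElem_f k S l).Corner

open Classical in
/-- `e_λ = ∑_{ν < λ} 1_ν`. -/
noncomputable def eLT : RSchur k S n :=
  ∑ v ∈ Finset.univ.filter (fun v : Comp r n => compLT v l), RSchur.f k S v v 1

/-- `B_R e_λ B_R ∩ B_R^λ`, an ideal of `B_R^λ`; here `B_R e_λ B_R` is the two-sided ideal of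
`B_R` generated by `e_λ`. -/
noncomputable def kerIdeal : Ideal (BCorner k S l) where
  carrier := {x | (x.1 : RSchur k S n) ∈ TwoSidedIdeal.span {eLT k S l}}
  add_mem' := fun hx hy => TwoSidedIdeal.add_mem (TwoSidedIdeal.span {eLT k S l}) hx hy
  zero_mem' := TwoSidedIdeal.zero_mem (TwoSidedIdeal.span {eLT k S l})
  smul_mem' := fun c x hx =>
    TwoSidedIdeal.mul_mem_left (TwoSidedIdeal.span {eLT k S l}) c.1 x.1 hx

theorem mem_kerIdeal {x : BCorner k S l} :
    x ∈ kerIdeal k S l ↔ (x.1 : RSchur k S n) ∈ TwoSidedIdeal.span {eLT k S l} := Iff.rfl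

instance : (kerIdeal k S l).IsTwoSided where
  mul_mem_of_left := fun {a} b hx => by
    rw [mem_kerIdeal] at hx ⊢
    exact TwoSidedIdeal.mul_mem_right (TwoSidedIdeal.span {eLT k S l}) a.1 b.1 hx

/-- `C_R^λ = B_R^λ / (B_R e_λ B_R ∩ B_R^λ)`. -/
abbrev CR : Type _ := BCorner k S l ⧸ kerIdeal k S l

/-- The natural projection `Π_R : B_R^λ → C_R^λ`. -/
noncomputable def projR : BCorner k S l →ₐ[k] CR k S l := Ideal.Quotient.mkₐ k (kerIdeal k S l)

/-- `f(λ,α,λ)` as an element of `B_R^λ = 1_λ B_R 1_λ`. -/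
noncomputable def fCorner (α : S.Elt) : BCorner k S l :=
  ⟨RSchur.f k S l l α, RSchur.f k S l l α, by
    change RSchur.f k S l l 1 * RSchur.f k S l l α * RSchur.f k S l l 1 = _
    rw [RSchur.one_mul_f, RSchur.f_mul_one]⟩

end Quotients

/-! ## `p`-partitions and the map `φ_λ` -/

section PPartition

variable {r n : ℕ} (p : ℕ)

/-- A `p`-partition: every part is `0` or a power of `p`. -/
def IsPPartition (l : Comp r n) : Prop :=
  IsPartition l ∧ ∀ i, l.1 i = 0 ∨ ∃ t, l.1 i = p ^ t

/-- `s_i`: the number of rows of length `p ^ i`. -/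
def mult (l : Comp r n) (i : ℕ) : ℕ := numRows l (p ^ i)

/-- The `a`-th row (from the top, `a` starting at `0`) among the rows of length `p ^ i`. -/
def nthRow (l : Comp r n) (i : ℕ) (a : Fin (mult p l i)) :
    {j // j ∈ Finset.univ.filter fun j => l.1 j = p ^ i} :=
  Finset.orderIsoOfFin _ rfl a

theorem nthRow_len (l : Comp r n) (i : ℕ) (a : Fin (mult p l i)) :
    l.1 (nthRow p l i a) = p ^ i :=
  (Finset.mem_filter.1 (nthRow p l i a).2).2

/-- `(i, a, b)` is sent to the `b`-th entry of the `a`-th row of length `p ^ i`. -/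
def labelFun (l : Comp r n) (y : Σ i : ℕ, Fin (mult p l i) × Fin (p ^ i)) : Fin r :=
  cell l ⟨nthRow p l y.1 y.2.1, Fin.cast (nthRow_len p l y.1 y.2.1).symm y.2.2⟩

variable {p}

theorem labelFun_bijective [hp : Fact p.Prime] {l : Comp r n} (hl : IsPPartition p l) :
    Function.Bijective (labelFun p l) := by
  constructor
  · rintro ⟨i, a, b⟩ ⟨i', a', b'⟩ h
    have h1 := (cell l).injective h
    obtain ⟨h2, h3⟩ := Sigma.mk.inj_iff.1 h1
    have hi : i = i' := by
      have e := nthRow_len p l i a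
      rw [show ((nthRow p l i a : Fin n)) = nthRow p l i' a' from h2, nthRow_len] at e
      exact (Nat.pow_right_injective hp.out.two_le e).symm
    subst hi
    have ha : a = a' := (Finset.orderIsoOfFin _ rfl).injective (Subtype.ext h2)
    subst ha
    have hb : b = b' := by
      have := eq_of_heq h3
      exact Fin.ext (by simpa using congrArg Fin.val this)
    rw [hb]
  · intro x
    obtain ⟨⟨j, b⟩, rfl⟩ := (cell l).surjective x
    obtain ⟨i, hi⟩ : ∃ i, l.1 j = p ^ i := by
      rcases hl.2 j with h | h
      · exact absurd b.2 (by omega)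
      · exact h
    obtain ⟨a, ha⟩ := (Finset.orderIsoOfFin
      (Finset.univ.filter fun j => l.1 j = p ^ i) rfl).surjective ⟨j, by simp [hi]⟩
    have hj : (nthRow p l i a : Fin n) = j := congrArg Subtype.val ha
    refine ⟨⟨i, a, Fin.cast hi b⟩, ?_⟩
    refine congrArg (cell l) (Sigma.ext hj ?_)
    exact (Fin.heq_ext_iff ((nthRow_len p l i a).trans hi.symm)).2 rfl

/-- The bijection between the triples `(i, a, b)` and the entries of the tableau: `(i, a, b)` is
the `b`-th entry of the `a`-th row of length `p ^ i`. -/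
noncomputable def label [Fact p.Prime] {l : Comp r n} (hl : IsPPartition p l) :
    (Σ i : ℕ, Fin (mult p l i) × Fin (p ^ i)) ≃ Fin r :=
  Equiv.ofBijective (labelFun p l) (labelFun_bijective hl)

/-- The homomorphism `φ_λ : ∏_i τ̄_{s_i} → τ̄_r` (the factors with `s_i = 0` are trivial):
`φ_λ(α)` maps the `b`-th entry of the `a`-th row of length `p ^ i` to the `b`-th entry of the
`α_i(a)`-th row of length `p ^ i`, or to `0` if `α_i(a) = 0`. -/
noncomputable def phi [Fact p.Prime] {l : Comp r n} (hl : IsPPartition p l) :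
    (∀ i : ℕ, PT (mult p l i)) →* PT r where
  toFun α := PT.mk fun x =>
    let y := (label hl).symm x
    Fin.cases (motive := fun _ => Fin (r + 1)) 0
      (fun a' => (label hl ⟨y.1, a', y.2.2⟩).succ) ((α y.1).app y.2.1.succ)
  map_one' := by
    refine PT.ext fun x => ?_
    refine Fin.cases (by simp) (fun x => ?_) x
    simp
  map_mul' α β := by
    refine PT.ext fun x => ?_
    refine Fin.cases (by simp) (fun x => ?_) x
    rw [PT.mul_app, PT.mk_app_succ, PT.mk_app_succ]
    simp only [Pi.mul_apply, PT.mul_app]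
    generalize (β ((label hl).symm x).1).app ((label hl).symm x).2.1.succ = c
    refine Fin.cases ?_ (fun a' => ?_) c
    · simp
    · simp only [Fin.cases_succ, PT.mk_app_succ]
      rw [Equiv.symm_apply_apply]

/-- The submonoid `S₀ · ∏_{i>0} 𝔖_{s_i}` of `∏_i τ̄_{s_i}`. -/
def prodSub (l : Comp r n) (S₀ : Submonoid (PT (mult p l 0))) :
    Submonoid (∀ i : ℕ, PT (mult p l i)) where
  carrier := {α | α 0 ∈ S₀ ∧ ∀ i, 0 < i → α i ∈ symSub (mult p l i)}
  one_mem' := ⟨one_mem _, fun _ _ => one_mem _⟩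
  mul_mem' := fun ha hb => ⟨mul_mem ha.1 hb.1, fun i hi => mul_mem (ha.2 i hi) (hb.2 i hi)⟩

variable [Fact p.Prime] {l : Comp r n} (hl : IsPPartition p l) (S : TransMonoid r)

/-- `S_r^λ = image(φ_λ) ∩ S_r`. -/
noncomputable def Slam : Submonoid (PT r) := MonoidHom.mrange (phi hl) ⊓ S.toSubmonoid

/-- `S' = φ_λ(τ̄_{s_0} · ∏_{i>0} 𝔖_{s_i}) ∩ S_r^λ`. -/
noncomputable def Sprime : Submonoid (PT r) :=
  (prodSub (p := p) l ⊤).map (phi hl) ⊓ Slam hl S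

theorem Sprime_le : Sprime hl S ≤ Slam hl S := inf_le_right

/-- The `k`-linear map `ψ_{λ,R} : k[S_r^λ] → B_R^λ`, `α ↦ f(λ,α,λ)`. -/
noncomputable def psi (k : Type*) [CommRing k] :
    MonoidAlgebra k (Slam hl S) →ₗ[k] BCorner k S l :=
  (Finsupp.linearCombination k fun α : Slam hl S => fCorner k S l ⟨α.1, α.2.2⟩) ∘ₗ
    (MonoidAlgebra.coeffLinearEquiv k).toLinearMap

/-- The inclusion `k[S'] → k[S_r^λ]`. -/
noncomputable def inclS (k : Type*) [CommRing k] :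
    MonoidAlgebra k (Sprime hl S) →ₐ[k] MonoidAlgebra k (Slam hl S) :=
  MonoidAlgebra.mapDomainAlgHom k k (Submonoid.inclusion (Sprime_le hl S))

end PPartition

end GenSchur

/-!
Modulo `B_R e_λ B_R` the elements `f(λ,γ,λ)` with `γ ∈ S'` stay independent because the elements of
this ideal have coefficients `0` there: for `ν < λ` the coefficient of `f(λ,γ,λ)` in
`f(λ,α,ν) f(ν,β,λ)` is divisible by `p`. Indeed the simultaneous rotation of all rows of `λ` is an
element of `G_λ` of `p`-power order, as `λ` is a `p`-partition. If the coefficient is nonzero, `α`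
hits all rows of length greater than one. If moreover a conjugate of the rotation were in
`G_R(λ,α,ν)`, then each of these rows would be hit from a `ν`-block which is at least as long,
contradicting `ν < λ`. So `p` divides the index of `G_R(λ,α,ν)` in `G_λ`, which divides the
coefficient.

Conversely, a colouring of `{1,…,r}` which is strictly finer than the rows and compatible with `α`
yields a `ν < λ` through which `f(λ,α,λ)` factors. Hence modulo `B_R e_λ B_R` only those `α` survive
which map each row to `0` or bijectively onto a row and which hit all rows of length greater than
one. Up to `G_λ`, these are the elements of `S'`.
-/

namespace GenSchur

section MonoidAlgebras

theorem lift_bijective_of_basis {k M A : Type*} [CommSemiring k] [Monoid M] [Semiring A]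
    [Algebra k A] (F : M →* A) (b : Module.Basis M k A) (h : ∀ m, b m = F m) :
    Function.Bijective (MonoidAlgebra.lift k A M F) := by
  have e : (MonoidAlgebra.lift k A M F).toLinearMap =
      ((MonoidAlgebra.basis M k).equiv b (Equiv.refl M)).toLinearMap :=
    (MonoidAlgebra.basis M k).ext fun m => by
      rw [LinearEquiv.coe_coe, Module.Basis.equiv_apply]
      simp [h]
  exact congrArg DFunLike.coe e ▸ ((MonoidAlgebra.basis M k).equiv b (Equiv.refl M)).bijective

/-- The isomorphism `k[M] ≅ A` given by a `k`-basis of `A` which is indexed multiplicatively by the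
monoid `M`. -/
noncomputable def algEquivOfBasis {k M A : Type*} [CommSemiring k] [Monoid M] [Semiring A]
    [Algebra k A] (F : M →* A) (b : Module.Basis M k A) (h : ∀ m, b m = F m) :
    MonoidAlgebra k M ≃ₐ[k] A :=
  AlgEquiv.ofBijective (MonoidAlgebra.lift k A M F) (lift_bijective_of_basis F b h)

/-- The isomorphism `k[M × N] ≅ k[M] ⊗ k[N]`. -/
noncomputable def prodAlgEquiv (k M N : Type*) [CommSemiring k] [Monoid M] [Monoid N] :
    MonoidAlgebra k (M × N) ≃ₐ[k] MonoidAlgebra k M ⊗[k] MonoidAlgebra k N :=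
  algEquivOfBasis
    { toFun x := MonoidAlgebra.single x.1 1 ⊗ₜ MonoidAlgebra.single x.2 1
      map_one' := rfl
      map_mul' x y := by simp [MonoidAlgebra.single_mul_single] }
    ((MonoidAlgebra.basis M k).tensorProduct (MonoidAlgebra.basis N k)) fun m => by
      rw [Module.Basis.tensorProduct_apply']
      rfl

/-- The isomorphism `k[∏ Mᵢ] ≅ ⨂ k[Mᵢ]` for a finite product. -/
noncomputable def piAlgEquiv (k : Type*) {ι : Type*} [Finite ι] (M : ι → Type*) [CommSemiring k]
    [∀ i, Monoid (M i)] :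
    MonoidAlgebra k (∀ i, M i) ≃ₐ[k] ⨂[k] i, MonoidAlgebra k (M i) :=
  algEquivOfBasis
    { toFun x := PiTensorProduct.tprod k fun i => MonoidAlgebra.single (x i) 1
      map_one' := rfl
      map_mul' x y := by
        rw [PiTensorProduct.tprod_mul_tprod]
        congr 1
        funext i
        simp [MonoidAlgebra.single_mul_single] }
    (Basis.piTensorProduct fun i => MonoidAlgebra.basis (M i) k) fun m => by
      rw [Basis.piTensorProduct_apply]
      rfl

end MonoidAlgebras

section TransformationMonoids

variable {r : ℕ}

theorem PT.ext_succ {α β : PT r} (h : ∀ x : Fin r, α.app x.succ = β.app x.succ) : α = β :=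
  PT.ext fun x => Fin.cases (by rw [PT.app_zero, PT.app_zero]) h x

instance : Subsingleton (PT 0) := ⟨fun _ _ => PT.ext_succ fun x => x.elim0⟩

theorem PT.exists_succ_of_app_eq_succ {α : PT r} {z : Fin (r + 1)} {x : Fin r}
    (h : α.app z = x.succ) : ∃ y : Fin r, z = y.succ := by
  rcases Fin.eq_zero_or_eq_succ z with rfl | hz
  · exact absurd (α.app_zero.symm.trans h).symm (Fin.succ_ne_zero x)
  · exact hz

@[simp] theorem permHom_app_succ (σ : Equiv.Perm (Fin r)) (x : Fin r) :
    (permHom r σ).app x.succ = (σ x).succ := rfl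

theorem permHom_injective (r : ℕ) : Function.Injective (permHom r) := fun _ _ h =>
  Equiv.ext fun x => Fin.succ_injective r (congrArg (fun α : PT r => α.app x.succ) h)

theorem permHom_app_injective (σ : Equiv.Perm (Fin r)) : Function.Injective (permHom r σ).app :=
  Function.LeftInverse.injective (g := (permHom r σ⁻¹).app) fun x => by
    rw [← PT.mul_app, ← map_mul, inv_mul_cancel, map_one, PT.one_app]

theorem mem_rook_of_succ {α : PT r}
    (h : ∀ x y : Fin r, α.app x.succ = α.app y.succ → α.app x.succ ≠ 0 → x = y) : α ∈ rook r := by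
  intro i hi x y hx hy
  obtain ⟨u, rfl⟩ := Fin.exists_succ_eq.2 hi
  obtain ⟨x, rfl⟩ := PT.exists_succ_of_app_eq_succ hx
  obtain ⟨y, rfl⟩ := PT.exists_succ_of_app_eq_succ hy
  rw [h x y (hx.trans hy.symm) (hx.trans_ne hi)]

theorem permHom_mem_rook (σ : Equiv.Perm (Fin r)) : permHom r σ ∈ rook r :=
  mem_rook_of_succ fun _ _ h _ => Fin.succ_injective r (permHom_app_injective σ h)

theorem mem_symSub_of_surj {α : PT r} (h : ∀ x' : Fin r, ∃ x : Fin r, α.app x.succ = x'.succ) :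
    α ∈ symSub r := by
  choose t ht using h
  have ht' : Function.Injective t := fun x y hxy => Fin.succ_injective _ <| by
    rw [← ht x, ← ht y, hxy]
  let τ := Equiv.ofBijective t (Finite.injective_iff_bijective.1 ht')
  refine ⟨τ⁻¹, PT.ext_succ fun x => ?_⟩
  obtain ⟨y, rfl⟩ := τ.surjective x
  exact (congrArg Fin.succ (τ.symm_apply_apply y)).trans (ht y).symm

end TransformationMonoids

section Weights

theorem exists_perm_comp_eq {X T : Type*} [Finite X] (F G : X → T)
    (h : ∀ t, Nat.card {x // F x = t} = Nat.card {x // G x = t}) :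
    ∃ π : Equiv.Perm X, ∀ x, G (π x) = F x :=
  ⟨Equiv.ofFiberEquiv fun t => (Finite.card_eq.1 (h t)).some, fun x => Equiv.ofFiberEquiv_map _ x⟩

theorem card_fiber_eq_of_perm {X T : Type*} {F G : X → T} (π : Equiv.Perm X)
    (h : ∀ x, G (π x) = F x) (t : T) :
    Nat.card {x // F x = t} = Nat.card {x // G x = t} :=
  Nat.card_congr (π.subtypeEquiv fun x => by rw [h])

variable {r n : ℕ}

theorem row_cell (l : Comp r n) (y : Σ j : Fin n, Fin (l.1 j)) : row l (cell l y) = y.1 := by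
  rw [row, Equiv.symm_apply_apply]

theorem card_row (l : Comp r n) (j : Fin n) : Nat.card {x : Fin r // row l x = j} = l.1 j := by
  have e : {x : Fin r // row l x = j} ≃ {y : Σ j : Fin n, Fin (l.1 j) // y.1 = j} :=
    (cell l).symm.subtypeEquiv fun _ => Iff.rfl
  rw [Nat.card_congr (e.trans (Equiv.sigmaSubtype j)), Nat.card_fin]

theorem row_len_pos (l : Comp r n) (x : Fin r) : 0 < l.1 (row l x) := by
  have : Nonempty {y : Fin r // row l y = row l x} := ⟨⟨x, rfl⟩⟩
  exact card_row l (row l x) ▸ Nat.card_pos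

/-- The sum over all points of `(r + 1) ^ (length of the row of the point)`. It is a function of
the multiset of row lengths, strictly monotone with respect to the lexicographic order of partitions
of `r`. -/
def weight (l : Comp r n) : ℕ := ∑ x, (r + 1) ^ l.1 (row l x)

theorem weight_eq_sum (l : Comp r n) : weight l = ∑ j, l.1 j * (r + 1) ^ l.1 j := by
  rw [weight, ← (cell l).sum_comp, Fintype.sum_sigma]
  simp only [row_cell, Finset.sum_const, Finset.card_univ, Fintype.card_fin, smul_eq_mul]

theorem numRows_eq_card (l : Comp r n) (m : ℕ) : numRows l m = Nat.card {j // l.1 j = m} := by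
  rw [numRows, Nat.card_eq_fintype_card, Fintype.card_subtype]

theorem Equi.weight_eq {l m : Comp r n} (h : Equi l m) : weight l = weight m := by
  obtain ⟨π, hπ⟩ := exists_perm_comp_eq l.1 m.1 fun t => by
    rw [← numRows_eq_card, ← numRows_eq_card, h t]
  rw [weight_eq_sum, weight_eq_sum]
  exact Fintype.sum_equiv π _ _ fun j => by rw [hπ]

theorem exists_isPartition_equi (v : Comp r n) : ∃ v' : Comp r n, IsPartition v' ∧ Equi v v' := by
  let e : Equiv.Perm (Fin n) := Fin.revPerm.trans (Tuple.sort v.1)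
  refine ⟨⟨fun i => v.1 (e i), (Equiv.sum_comp e v.1).trans v.2⟩, ?_, fun m => ?_⟩
  · exact (Tuple.monotone_sort v.1).comp_antitone Fin.rev_anti
  · refine (numRows_eq_card v m).trans (Eq.trans ?_ (numRows_eq_card _ m).symm)
    exact (card_fiber_eq_of_perm e (fun _ => rfl) m).symm

theorem IsPartition.sum_tail_lt {v : Comp r n} (hv : IsPartition v) (k : Fin n) :
    ∑ j with ¬ j < k, v.1 j * (r + 1) ^ v.1 j < (r + 1) ^ (v.1 k + 1) := by
  calc ∑ j with ¬ j < k, v.1 j * (r + 1) ^ v.1 j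
      ≤ ∑ j with ¬ j < k, v.1 j * (r + 1) ^ v.1 k := by
        refine Finset.sum_le_sum fun j hj => Nat.mul_le_mul_left _ ?_
        exact Nat.pow_le_pow_right r.succ_pos (hv (not_lt.1 (Finset.mem_filter.1 hj).2))
    _ = (∑ j with ¬ j < k, v.1 j) * (r + 1) ^ v.1 k := (Finset.sum_mul _ _ _).symm
    _ ≤ r * (r + 1) ^ v.1 k :=
        Nat.mul_le_mul_right _
          ((Finset.sum_le_sum_of_subset (Finset.filter_subset _ _)).trans v.2.le)
    _ < (r + 1) * (r + 1) ^ v.1 k := Nat.mul_lt_mul_of_pos_right r.lt_succ_self (by positivity)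
    _ = (r + 1) ^ (v.1 k + 1) := (pow_succ' _ _).symm

theorem lexLT.weight_lt {v l : Comp r n} (hv : IsPartition v) (h : lexLT v l) :
    weight v < weight l := by
  obtain ⟨k, hk, hlt⟩ := h
  let g : Fin n → ℕ := fun j => l.1 j * (r + 1) ^ l.1 j
  have hhead : ∑ j with j < k, v.1 j * (r + 1) ^ v.1 j = ∑ j with j < k, g j :=
    Finset.sum_congr rfl fun j hj => by rw [hk j (Finset.mem_filter.1 hj).2]
  have htail : ∑ j with ¬ j < k, v.1 j * (r + 1) ^ v.1 j < ∑ j with ¬ j < k, g j :=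
    calc _ < (r + 1) ^ (v.1 k + 1) := hv.sum_tail_lt k
      _ ≤ (r + 1) ^ l.1 k := Nat.pow_le_pow_right r.succ_pos hlt
      _ ≤ g k := Nat.le_mul_of_pos_left _ (by omega)
      _ ≤ _ := Finset.single_le_sum (fun _ _ => Nat.zero_le _) (by simp)
  rw [weight_eq_sum, weight_eq_sum, ← Finset.sum_filter_add_sum_filter_not Finset.univ (· < k),
    ← Finset.sum_filter_add_sum_filter_not Finset.univ (· < k) g]
  exact add_lt_add_of_le_of_lt hhead.le htail

theorem lexLT_trichotomy (v l : Comp r n) : lexLT v l ∨ v = l ∨ lexLT l v :=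
  (lt_trichotomy (toLex v.1) (toLex l.1)).imp_right <|
    Or.imp_left fun h => Subtype.ext (toLex_inj.1 h)

theorem compLT_iff_weight_lt {v l : Comp r n} : compLT v l ↔ weight v < weight l := by
  constructor
  · rintro ⟨v', l', hv', ev, -, el, h⟩
    rw [ev.weight_eq, el.weight_eq]
    exact h.weight_lt hv'
  · intro h
    obtain ⟨v', hv', ev⟩ := exists_isPartition_equi v
    obtain ⟨l', hl', el⟩ := exists_isPartition_equi l
    rw [ev.weight_eq, el.weight_eq] at h
    refine ⟨v', l', hv', ev, hl', el, ?_⟩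
    rcases lexLT_trichotomy v' l' with hlt | rfl | hgt
    · exact hlt
    · exact absurd h (lt_irrefl _)
    · exact absurd h (hgt.weight_lt hl').not_gt

theorem weight_le_of_perm {l m : Comp r n} (θ : Equiv.Perm (Fin r))
    (h : ∀ x, l.1 (row l x) ≤ m.1 (row m (θ x))) : weight l ≤ weight m := by
  rw [weight, weight, ← Equiv.sum_comp θ (fun x => (r + 1) ^ m.1 (row m x))]
  exact Finset.sum_le_sum fun x _ => Nat.pow_le_pow_right r.succ_pos (h x)

theorem weight_lt_of_perm {l m : Comp r n} (θ : Equiv.Perm (Fin r))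
    (h : ∀ x, l.1 (row l x) ≤ m.1 (row m (θ x)))
    (h' : ∃ x, l.1 (row l x) < m.1 (row m (θ x))) : weight l < weight m := by
  rw [weight, weight, ← Equiv.sum_comp θ (fun x => (r + 1) ^ m.1 (row m x))]
  obtain ⟨x, hx⟩ := h'
  have : 0 < r := x.pos
  exact Finset.sum_lt_sum (fun x _ => Nat.pow_le_pow_right r.succ_pos (h x))
    ⟨x, Finset.mem_univ _, Nat.pow_lt_pow_right (by omega) hx⟩

end Weights

section ColourSubgroups

variable {r n : ℕ} {T : Type*}

/-- The subgroup of all permutations which preserve the colouring `c`. The Young subgroup `G_λ` is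
`colourYoung (row λ)`. -/
def colourYoung (c : Fin r → T) : Subgroup (Equiv.Perm (Fin r)) where
  carrier := {σ | ∀ x, c (σ x) = c x}
  one_mem' := fun _ => rfl
  mul_mem' := fun {a b} ha hb x => (ha (b x)).trans (hb x)
  inv_mem' := fun {a} ha x => by simpa using (ha (a⁻¹ x)).symm

theorem mem_colourYoung {c : Fin r → T} {σ : Equiv.Perm (Fin r)} :
    σ ∈ colourYoung c ↔ ∀ x, c (σ x) = c x := Iff.rfl

theorem mem_young_inf_colourYoung {l : Comp r n} {d : Fin r → T} {σ : Equiv.Perm (Fin r)} :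
    σ ∈ young l ⊓ colourYoung d ↔ σ ∈ colourYoung fun x => (row l x, d x) :=
  ⟨fun h x => Prod.ext (h.1 x) (h.2 x),
    fun h => ⟨fun x => congrArg Prod.fst (h x), fun x => congrArg Prod.snd (h x)⟩⟩

theorem swap_mem_young {l : Comp r n} {u u' : Fin r} (h : row l u = row l u') :
    Equiv.swap u u' ∈ young l := fun x => by
  rw [Equiv.swap_apply_def]
  split_ifs with hu hu'
  · rw [hu, h]
  · rw [hu', h]
  · rfl

theorem exists_comp_of_colouring (hn : r ≤ n) (c : Fin r → T) :
    ∃ (v : Comp r n) (τ : Equiv.Perm (Fin r)),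
      ∀ x y, row v x = row v y ↔ c (τ x) = c (τ y) := by
  classical
  obtain ⟨ι⟩ : Nonempty (Set.range c ↪ Fin n) :=
    Function.Embedding.nonempty_of_card_le ((Fintype.card_range_le c).trans (by simpa using hn))
  let d : Fin r → Fin n := fun x => ι ⟨c x, x, rfl⟩
  have hd : ∀ x y, d x = d y ↔ c x = c y := fun x y =>
    (ι.apply_eq_iff_eq _ _).trans Subtype.mk_eq_mk
  let v : Comp r n := ⟨fun j => Nat.card {x // d x = j}, by
    simp_rw [Nat.card_eq_fintype_card]
    rw [← Fintype.card_sigma, Fintype.card_congr (Equiv.sigmaFiberEquiv d), Fintype.card_fin]⟩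
  obtain ⟨τ, hτ⟩ := exists_perm_comp_eq (row v) d fun t => card_row v t
  exact ⟨v, τ, fun x y => by rw [← hd, hτ, hτ]⟩

theorem compLT_of_refines {c : Fin r → T} {l v : Comp r n} {τ : Equiv.Perm (Fin r)}
    (hv : ∀ x y, row v x = row v y ↔ c (τ x) = c (τ y))
    (hc : ∀ x y, c x = c y → row l x = row l y)
    (hs : ∃ x y, row l x = row l y ∧ c x ≠ c y) : compLT v l := by
  have card_v : ∀ x, v.1 (row v x) = {y | c y = c (τ x)}.ncard := fun x =>
    (card_row v _).symm.trans (Nat.card_congr (τ.subtypeEquiv fun y => hv y x))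
  have card_l : ∀ x, l.1 (row l x) = {y | row l y = row l x}.ncard := fun x => (card_row l _).symm
  have hsub : ∀ x, {y | c y = c x} ⊆ {y | row l y = row l x} := fun x y => hc y x
  refine compLT_iff_weight_lt.2 (weight_lt_of_perm τ (fun x => ?_) ?_)
  · rw [card_v, card_l]
    exact Set.ncard_le_ncard (hsub _)
  · obtain ⟨x, y, hxy, hne⟩ := hs
    refine ⟨τ.symm x, ?_⟩
    rw [card_v, card_l, Equiv.apply_symm_apply]
    exact Set.ncard_lt_ncard ((hsub x).ssubset_of_mem_notMem (a := y) hxy.symm hne.symm)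

theorem exists_compLT_conj (hn : r ≤ n) {l : Comp r n} {d : Fin r → T}
    (h : ∃ x y, row l x = row l y ∧ d x ≠ d y) :
    ∃ v : Comp r n, compLT v l ∧ ∃ τ : Equiv.Perm (Fin r),
      ∀ σ, σ ∈ young l ⊓ colourYoung d ↔ τ⁻¹ * σ * τ ∈ young v := by
  obtain ⟨v, τ, hv⟩ := exists_comp_of_colouring hn fun x => (row l x, d x)
  refine ⟨v, compLT_of_refines (c := fun x => (row l x, d x)) hv ?_ ?_, τ, fun σ => ?_⟩
  · exact fun x y hxy => (Prod.ext_iff.1 hxy).1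
  · obtain ⟨x, y, hxy, hd⟩ := h
    exact ⟨x, y, hxy, fun he => hd (Prod.ext_iff.1 he).2⟩
  · rw [mem_young_inf_colourYoung, mem_colourYoung, τ.surjective.forall]
    exact forall_congr' fun x => by rw [hv]; simp

end ColourSubgroups

section Stability

variable {r n : ℕ} {H K K' L : Subgroup (Equiv.Perm (Fin r))} {α β : PT r}

/-- Left multiplication by `H` preserves the coset `α K`. For `H = G_λ` and `K = G_μ` this says
that `G_R(λ,α,μ)` is all of `G_λ`. -/
def IsStable (H K : Subgroup (Equiv.Perm (Fin r))) (α : PT r) : Prop :=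
  ∀ σ ∈ H, ∃ π ∈ K, permHom r σ * α = α * permHom r π

theorem IsStable.mul (hα : IsStable H K α) (hβ : IsStable K L β) : IsStable H L (α * β) := by
  intro σ hσ
  obtain ⟨π, hπ, hσα⟩ := hα σ hσ
  obtain ⟨ρ, hρ, hπβ⟩ := hβ π hπ
  exact ⟨ρ, hρ, by rw [← mul_assoc, hσα, mul_assoc, hπβ, mul_assoc]⟩

theorem IsStable.mono_right (hα : IsStable H K α) (hK : K ≤ K') : IsStable H K' α := fun σ hσ =>
  (hα σ hσ).imp fun _ h => ⟨hK h.1, h.2⟩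

theorem exists_mem_permHom_mul_permHom_iff {σ τ : Equiv.Perm (Fin r)} :
    (∃ π ∈ K, permHom r σ * permHom r τ = permHom r τ * permHom r π) ↔ τ⁻¹ * σ * τ ∈ K := by
  simp only [← map_mul, (permHom_injective r).eq_iff]
  constructor
  · rintro ⟨π, hπ, h⟩
    rwa [mul_assoc, h, inv_mul_cancel_left]
  · exact fun h => ⟨_, h, by simp only [mul_assoc, mul_inv_cancel_left]⟩

theorem isStable_permHom {τ : Equiv.Perm (Fin r)} :
    IsStable H K (permHom r τ) ↔ ∀ σ ∈ H, τ⁻¹ * σ * τ ∈ K :=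
  forall₂_congr fun _ _ => exists_mem_permHom_mul_permHom_iff

variable {S : TransMonoid r} {l m v : Comp r n}

theorem mem_GR_iff {α : S.Elt} {σ : Equiv.Perm (Fin r)} :
    σ ∈ GR l m α ↔ σ ∈ young l ∧ ∃ π ∈ young m, permHom r σ * α.1 = α.1 * permHom r π :=
  and_congr_right fun _ => exists_congr fun _ => and_congr_right fun _ => Subtype.ext_iff

theorem IsStable.nR_eq {α : S.Elt} (h : IsStable (young l) (young m) α.1) :
    nR (dc S l m α) = Nat.card (young l) := by
  have : GR l m α = young l := le_antisymm (GR_le l m α) fun σ hσ => mem_GR_iff.2 ⟨hσ, h σ hσ⟩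
  rw [nR_dc, this]

theorem IsStable.dc_mul {β : S.Elt} (h : IsStable (young v) (young m) β.1) (α : S.Elt)
    {ρ : Equiv.Perm (Fin r)} (hρ : ρ ∈ young v) :
    dc S l m (α * S.perm ρ * β) = dc S l m (α * β) := by
  obtain ⟨π, hπ, hρβ⟩ := h ρ hρ
  have hρβ' : S.perm ρ * β = β * S.perm π := Subtype.ext hρβ
  rw [mul_assoc, hρβ', ← mul_assoc, dc_mul_right _ hπ]

theorem IsStable.structConst_eq {α β : S.Elt} (h : IsStable (young v) (young m) β.1)
    (hn : nR (dc S l m (α * β)) = nR (dc S l v α)) (D : DC S l m) :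
    structConst (dc S l v α) (dc S v m β) D = if dc S l m (α * β) = D then 1 else 0 := by
  have hnumN : numN (dc S l v α) (dc S v m β) D =
      if dc S l m (α * β) = D then Nat.card (young v) else 0 := by
    rw [numN_dc]
    simp only [h.dc_mul α (Subtype.property _)]
    split_ifs with hD <;> simp [hD]
  rw [structConst, hnumN, h.nR_eq]
  split_ifs with hD
  · rw [← hD, hn, Nat.div_self (Nat.mul_pos (nR_pos _) Nat.card_pos)]
  · rw [mul_zero, Nat.zero_div]

end Stability

namespace RSchur

variable {k : Type*} [CommRing k] {r n : ℕ} {S : TransMonoid r} {a b l m v : Comp r n}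

theorem f_coord_same (α : S.Elt) (D : DC S l m) :
    f k S l m α l m D = if D = dc S l m α then 1 else 0 := by
  simp [f, Pi.single_apply]

theorem f_coord_left_ne (h : a ≠ l) (m : Comp r n) (α : S.Elt) (D : DC S a b) :
    f k S l m α a b D = 0 := by
  simp [f, Pi.single_eq_of_ne h]

theorem f_coord_right_ne (h : b ≠ m) (l : Comp r n) (α : S.Elt) (D : DC S a b) :
    f k S l m α a b D = 0 := by
  rcases eq_or_ne a l with rfl | ha
  · simp [f, Pi.single_eq_of_ne h]
  · exact f_coord_left_ne ha m α D

theorem f_mul_f_coord (α β : S.Elt) (D : DC S l m) :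
    (f k S l v α * f k S v m β) l m D = structConst (dc S l v α) (dc S v m β) D := by
  rw [mul_coord, Finset.sum_eq_single v]
  · simp [f_coord_same]
  · intro b _ hb
    simp [f_coord_right_ne hb]
  · simp

theorem f_mul_f_of_isStable {α β : S.Elt} (h : IsStable (young v) (young m) β.1)
    (hn : nR (dc S l m (α * β)) = nR (dc S l v α)) :
    f k S l v α * f k S v m β = f k S l m (α * β) := by
  ext a b D
  rcases eq_or_ne a l with rfl | ha
  · rcases eq_or_ne b m with rfl | hb
    · rw [f_mul_f_coord, h.structConst_eq hn, f_coord_same]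
      simp [eq_comm]
    · rw [f_coord_right_ne hb, mul_coord]
      simp [f_coord_right_ne hb]
  · rw [f_coord_left_ne ha, mul_coord]
    simp [f_coord_left_ne ha]

/-- The ideal `B_R e_λ B_R` of `B_R`. -/
noncomputable abbrev eIdeal (k : Type*) [CommRing k] (S : TransMonoid r) (l : Comp r n) :
    TwoSidedIdeal (RSchur k S n) := TwoSidedIdeal.span {eLT k S l}

theorem f_mul_eLT (h : compLT v l) (α : S.Elt) : f k S m v α * eLT k S l = f k S m v α := by
  classical
  rw [eLT, Finset.mul_sum, Finset.sum_eq_single v]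
  · exact f_mul_one m v α
  · intro u _ hu
    ext a b D
    rcases eq_or_ne b u with rfl | hb
    · rw [mul_f_coord_same, f_coord_right_ne hu, zero_coord]
    · rw [mul_f_coord_ne _ hb, zero_coord]
  · exact fun hv => absurd (Finset.mem_filter_univ v |>.2 h) hv

theorem f_mul_f_mem_eIdeal (h : compLT v l) (α β : S.Elt) :
    f k S a v α * f k S v b β ∈ eIdeal k S l := by
  rw [← f_mul_eLT h α]
  exact TwoSidedIdeal.mul_mem_right _ _ _
    (TwoSidedIdeal.mul_mem_left _ _ _ (TwoSidedIdeal.subset_span rfl))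

theorem eLT_mul_coord (h : ¬ compLT v l) (z : RSchur k S n) (D : DC S v m) :
    (eLT k S l * z) v m D = 0 := by
  classical
  rw [eLT, Finset.sum_mul, sum_coord]
  refine Finset.sum_eq_zero fun u hu => f_mul_coord_ne _ ?_ _ _
  rintro rfl
  exact h (Finset.mem_filter_univ v |>.1 hu)

theorem coord_eq_zero_of_mem_eIdeal {p : ℕ} [CharP k p] {D : DC S a b}
    (h : ∀ v, compLT v l → ∀ (D₁ : DC S a v) (D₂ : DC S v b), p ∣ structConst D₁ D₂ D)
    {x : RSchur k S n} (hx : x ∈ eIdeal k S l) : x a b D = 0 := by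
  rw [TwoSidedIdeal.mem_span_iff_mem_addSubgroup_closure] at hx
  induction hx using AddSubgroup.closure_induction with
  | mem x hx =>
    obtain ⟨-, ⟨y, -, e, rfl, rfl⟩, z, -, rfl⟩ := hx
    change (y * eLT k S l * z) a b D = 0
    rw [mul_assoc, mul_coord]
    refine Finset.sum_eq_zero fun v _ => Finset.sum_eq_zero fun D₁ _ =>
      Finset.sum_eq_zero fun D₂ _ => ?_
    by_cases hv : compLT v l
    · rw [(CharP.cast_eq_zero_iff k p _).2 (h v hv D₁ D₂), mul_zero]
    · rw [eLT_mul_coord hv z D₂, mul_zero, zero_mul]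
  | zero => rfl
  | add x y _ _ hx hy => rw [add_coord, hx, hy, add_zero]
  | neg x _ hx =>
    have hneg : (-x + x) a b D = 0 := by rw [neg_add_cancel, zero_coord]
    rwa [add_coord, hx, add_zero] at hneg

variable {T : Type*}

theorem f_mem_eIdeal_of_GR_eq (hn : r ≤ n) {d : Fin r → T}
    (hd : ∃ x y, row l x = row l y ∧ d x ≠ d y) {α : S.Elt}
    (hα : GR l l α = young l ⊓ colourYoung d) : f k S l l α ∈ eIdeal k S l := by
  obtain ⟨v, hvl, τ, hτ⟩ := exists_compLT_conj hn hd
  have hfac : S.perm τ * (S.perm τ⁻¹ * α) = α := by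
    rw [← mul_assoc, ← map_mul, mul_inv_cancel, map_one, one_mul]
  have hτ_inv : IsStable (young v) (young l ⊓ colourYoung d) (permHom r τ⁻¹) :=
    isStable_permHom.2 fun σ hσ => (hτ _).2 (by simpa [mul_assoc] using hσ)
  have hst : IsStable (young l ⊓ colourYoung d) (young l) α.1 := fun σ hσ =>
    (mem_GR_iff.1 (hα.symm ▸ hσ)).2
  have hGR : GR l v (S.perm τ) = young l ⊓ colourYoung d := by
    ext σ
    exact mem_GR_iff.trans ((and_congr_right' exists_mem_permHom_mul_permHom_iff).trans
      ⟨fun h => (hτ σ).2 h.2, fun h => ⟨h.1, (hτ σ).1 h⟩⟩)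
  have hmul := f_mul_f_of_isStable (k := k) (l := l) (α := S.perm τ)
    (β := S.perm τ⁻¹ * α) (hτ_inv.mul hst) (by rw [hfac, nR_dc, nR_dc, hα, hGR])
  rw [hfac] at hmul
  exact hmul ▸ f_mul_f_mem_eIdeal hvl _ _

theorem f_mem_eIdeal_of_isStable (hn : r ≤ n) {d : Fin r → T}
    (hd : ∃ x y, row l x = row l y ∧ d x ≠ d y) {α : S.Elt}
    (hα : IsStable (young l) (young l ⊓ colourYoung d) α.1) : f k S l l α ∈ eIdeal k S l := by
  obtain ⟨v, hvl, τ, hτ⟩ := exists_compLT_conj hn hd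
  have hfac : α * S.perm τ * S.perm τ⁻¹ = α := by
    rw [mul_assoc, ← map_mul, mul_inv_cancel, map_one, mul_one]
  have hατ : IsStable (young l) (young v) (α * S.perm τ).1 :=
    hα.mul (isStable_permHom.2 fun σ => (hτ σ).1)
  have hτ_inv : IsStable (young v) (young l) (permHom r τ⁻¹) :=
    isStable_permHom.2 fun σ hσ => ((hτ _).2 (by simpa [mul_assoc] using hσ)).1
  have hmul := f_mul_f_of_isStable (k := k) (l := l) (α := α * S.perm τ) (β := S.perm τ⁻¹) hτ_inv
    (by rw [hfac, (hα.mono_right inf_le_left).nR_eq, hατ.nR_eq])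
  rw [hfac] at hmul
  exact hmul ▸ f_mul_f_mem_eIdeal hvl _ _

end RSchur

section Divisibility

theorem dvd_index_of_conj_notMem {G : Type*} [Group G] (H : Subgroup G) {p : ℕ}
    [hp : Fact p.Prime] {g : G} {N : ℕ} (hg : g ^ p ^ N = 1) (h : ∀ s, s⁻¹ * g * s ∉ H) :
    p ∣ H.index := by
  by_contra hpH
  obtain ⟨t, -, ht⟩ := (Nat.dvd_prime_pow hp.out).1 (orderOf_dvd_of_pow_eq_one hg)
  have hP : IsPGroup p (Subgroup.zpowers g) := .of_card ((Nat.card_zpowers g).trans ht)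
  obtain ⟨x, hx⟩ := hP.nonempty_fixed_point_of_prime_not_dvd_card (G ⧸ H) hpH
  obtain ⟨s, rfl⟩ := QuotientGroup.mk_surjective x
  have hs : ((g * s : G) : G ⧸ H) = s := hx ⟨g, Subgroup.mem_zpowers g⟩
  exact h s (mul_assoc s⁻¹ g s ▸ QuotientGroup.eq.1 hs.symm)

variable {r n : ℕ} {S : TransMonoid r} {l m v : Comp r n}

theorem nR_dvd_numN (α β : S.Elt) (D : DC S l m) :
    nR (dc S v m β) ∣ numN (dc S l v α) (dc S v m β) D := by
  classical
  have hsum : numN (dc S l v α) (dc S v m β) D =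
      ∑ ρ : young v, if dc S l m (α * S.perm ρ * β) = D then 1 else 0 := by
    rw [numN_dc, Nat.card_eq_fintype_card, Fintype.card_subtype, Finset.card_filter]
  rw [hsum, nR_dc, ← nat_card_subgroupOf (GR_le v m β), ← mul_one (Nat.card _)]
  refine card_dvd_sum _ _ _ ?_ fun _ => one_dvd _
  rintro ρ κ ⟨-, π, hπ, hκβ⟩
  have hκβ' : S.perm (κ : Equiv.Perm (Fin r)) * β = β * S.perm π := hκβ
  rw [Subgroup.coe_mul, map_mul, mul_assoc α, mul_assoc (S.perm _) _ β, hκβ', ← mul_assoc,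
    ← mul_assoc, dc_mul_right _ hπ, mul_assoc α]

theorem index_dvd_structConst {γ : S.Elt} (hγ : IsStable (young l) (young m) γ.1) (α β : S.Elt) :
    ((GR l v α).subgroupOf (young l)).index ∣
      structConst (dc S l v α) (dc S v m β) (dc S l m γ) := by
  obtain ⟨t, ht⟩ := nR_dvd_numN (l := l) (v := v) α β (dc S l m γ)
  have hindex := ((GR l v α).subgroupOf (young l)).card_mul_index
  rw [nat_card_subgroupOf (GR_le l v α), ← nR_dc] at hindex
  have hspec := structConst_spec (dc S l v α) (dc S v m β) (dc S l m γ)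
  rw [hγ.nR_eq, ht, ← hindex] at hspec
  refine ⟨t, Nat.eq_of_mul_eq_mul_right (Nat.mul_pos (nR_pos _) (nR_pos _)) (hspec.trans ?_)⟩
  ring

/-- The map `γ` hits every element of a row of length greater than one. -/
def HitsLargeRows (l : Comp r n) (γ : PT r) : Prop :=
  ∀ x : Fin r, 1 < l.1 (row l x) → ∃ z : Fin r, γ.app z.succ = x.succ

theorem HitsLargeRows.of_mul {α β : PT r} (h : HitsLargeRows l (α * β)) : HitsLargeRows l α := by
  intro x hx
  obtain ⟨z, hz⟩ := h x hx
  obtain ⟨y, hy⟩ := PT.exists_succ_of_app_eq_succ (z := β.app z.succ) hz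
  exact ⟨y, hy ▸ hz⟩

theorem HitsLargeRows.perm_mul {α : PT r} (h : HitsLargeRows l α) {σ : Equiv.Perm (Fin r)}
    (hσ : σ ∈ young l) : HitsLargeRows l (permHom r σ * α) := by
  intro x hx
  obtain ⟨z, hz⟩ := h (σ⁻¹ x) (by rwa [inv_mem hσ x])
  exact ⟨z, by rw [PT.mul_app, hz, permHom_app_succ]; simp⟩

theorem row_len_le_of_commute {α : PT r} {g ρ : Equiv.Perm (Fin r)}
    (hg : ∀ x y, row l x = row l y → ∃ i : ℕ, (g ^ i) x = y) (hρ : ρ ∈ young v)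
    (h : permHom r g * α = α * permHom r ρ) {x z : Fin r} (hz : α.app z.succ = x.succ) :
    l.1 (row l x) ≤ v.1 (row v z) := by
  have hpow : ∀ i : ℕ, permHom r (g ^ i) * α = α * permHom r (ρ ^ i) := fun i => by
    have hcomm : SemiconjBy α (permHom r ρ) (permHom r g) := h.symm
    simpa only [map_pow] using (hcomm.pow_right i).eq.symm
  have hhit : ∀ y : {y : Fin r // row l y = row l x}, ∃ w : {w : Fin r // row v w = row v z},
      α.app w.1.succ = y.1.succ := by
    rintro ⟨y, hy⟩
    obtain ⟨i, rfl⟩ := hg x y hy.symm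
    refine ⟨⟨(ρ ^ i) z, pow_mem hρ i z⟩, ?_⟩
    rw [← permHom_app_succ, ← PT.mul_app, ← hpow i, PT.mul_app, hz, permHom_app_succ]
  choose t ht using hhit
  rw [← card_row, ← card_row]
  refine Nat.card_le_card_of_injective t fun a b hab => ?_
  exact Subtype.ext (Fin.succ_injective _ (by rw [← ht, ← ht, hab]))

theorem HitsLargeRows.weight_le {α : PT r} (hα : HitsLargeRows l α)
    (h : ∀ x z : Fin r, α.app z.succ = x.succ → l.1 (row l x) ≤ v.1 (row v z)) :
    weight l ≤ weight v := by
  classical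
  choose s hs using fun x : {x : Fin r // 1 < l.1 (row l x)} => hα x.1 x.2
  have hinj : Function.Injective s := fun x y hxy =>
    Subtype.ext (Fin.succ_injective _ (by rw [← hs, ← hs, hxy]))
  let e : {x : Fin r // 1 < l.1 (row l x)} ≃ {y // y ∈ Set.range s} := Equiv.ofInjective s hinj
  refine weight_le_of_perm e.extendSubtype fun x => ?_
  by_cases hx : 1 < l.1 (row l x)
  · rw [e.extendSubtype_apply_of_mem x hx]
    exact h x (s ⟨x, hx⟩) (hs ⟨x, hx⟩)
  · exact (not_lt.1 hx).trans (row_len_pos v _)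

theorem HitsLargeRows.of_numN_ne_zero {α β γ : S.Elt} (hγ : HitsLargeRows l γ.1)
    (h : numN (dc S l v α) (dc S v m β) (dc S l m γ) ≠ 0) : HitsLargeRows l α.1 := by
  rw [numN_dc] at h
  obtain ⟨⟨⟨ρ, hρ⟩, hD⟩⟩ := (Nat.card_ne_zero.1 h).1
  obtain ⟨σ, hσ, π, -, hγ'⟩ := dc_eq_iff.1 hD.symm
  have hγ'' : permHom r σ * γ.1 * permHom r π = α.1 * (permHom r ρ * β.1) :=
    (congrArg Subtype.val hγ').trans (mul_assoc _ _ _)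
  have hσγ : HitsLargeRows l (permHom r σ * γ.1 * permHom r π * permHom r π⁻¹) := by
    rw [mul_assoc (_ * _), ← map_mul, mul_inv_cancel, map_one, mul_one]
    exact hγ.perm_mul hσ
  rw [hγ''] at hσγ
  exact hσγ.of_mul.of_mul

theorem prime_dvd_structConst {p : ℕ} [Fact p.Prime] {g : Equiv.Perm (Fin r)} (hgl : g ∈ young l)
    {N : ℕ} (hgN : g ^ p ^ N = 1) (hg : ∀ x y, row l x = row l y → ∃ i : ℕ, (g ^ i) x = y)
    {γ : S.Elt} (hγs : IsStable (young l) (young m) γ.1) (hγ : HitsLargeRows l γ.1)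
    (hv : compLT v l) (D₁ : DC S l v) (D₂ : DC S v m) :
    p ∣ structConst D₁ D₂ (dc S l m γ) := by
  induction D₁ using DC.ind with | h α =>
  induction D₂ using DC.ind with | h β =>
  by_cases hN : numN (dc S l v α) (dc S v m β) (dc S l m γ) = 0
  · rw [structConst, hN, mul_zero, Nat.zero_div]
    exact dvd_zero p
  refine (dvd_index_of_conj_notMem _ (g := ⟨g, hgl⟩) (Subtype.ext hgN) ?_).trans
    (index_dvd_structConst hγs α β)
  rintro ⟨σ, hσ⟩ hmem
  obtain ⟨-, ρ, hρ, hcomm⟩ := mem_GR_iff.1 (show σ⁻¹ * g * σ ∈ GR l v α from hmem)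
  have hσα : permHom r g * (permHom r σ * α.1) = permHom r σ * α.1 * permHom r ρ := by
    rw [mul_assoc, ← hcomm, ← mul_assoc, ← mul_assoc, ← map_mul, ← map_mul, mul_assoc σ⁻¹,
      mul_inv_cancel_left]
  exact (compLT_iff_weight_lt.1 hv).not_ge (((hγ.of_numN_ne_zero hN).perm_mul hσ).weight_le
    fun _ _ => row_len_le_of_commute hg hρ hσα)

end Divisibility

section Rotation

open Fin.NatCast in
theorem finRotate_pow_apply {m : ℕ} [NeZero m] (i : ℕ) (a : Fin m) :
    (finRotate m ^ i) a = a + (i : Fin m) := by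
  induction i with
  | zero => simp
  | succ i ih =>
    rw [pow_succ', Equiv.Perm.mul_apply, ih, finRotate_apply]
    simp [add_assoc]

theorem finRotate_pow_self (m : ℕ) : finRotate m ^ m = 1 := by
  rcases m.eq_zero_or_pos with rfl | hm
  · exact Subsingleton.elim _ _
  · have : NeZero m := ⟨hm.ne'⟩
    exact Equiv.ext fun a => by simp [finRotate_pow_apply]

theorem exists_finRotate_pow_eq {m : ℕ} (a b : Fin m) : ∃ i : ℕ, (finRotate m ^ i) a = b := by
  have : NeZero m := ⟨a.pos.ne'⟩
  exact ⟨(b - a).val, by simp [finRotate_pow_apply]⟩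

variable {r n : ℕ}

/-- The simultaneous cyclic rotation of all rows. -/
def rotation (l : Comp r n) : Equiv.Perm (Fin r) :=
  (cell l).permCongr (Equiv.sigmaCongrRight fun j => finRotate (l.1 j))

theorem rotation_cell (l : Comp r n) (y : Σ j : Fin n, Fin (l.1 j)) :
    rotation l (cell l y) = cell l ⟨y.1, finRotate (l.1 y.1) y.2⟩ := by
  rw [rotation, Equiv.permCongr_apply, Equiv.symm_apply_apply]
  rfl

theorem rotation_pow_cell (l : Comp r n) (i : ℕ) (y : Σ j : Fin n, Fin (l.1 j)) :
    (rotation l ^ i) (cell l y) = cell l ⟨y.1, (finRotate (l.1 y.1) ^ i) y.2⟩ := by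
  induction i with
  | zero => rfl
  | succ i ih =>
    rw [pow_succ', Equiv.Perm.mul_apply, ih, pow_succ', rotation_cell]
    rfl

theorem rotation_mem_young (l : Comp r n) : rotation l ∈ young l :=
  (cell l).surjective.forall.2 fun y => by rw [rotation_cell, row_cell, row_cell]

theorem exists_rotation_pow_eq (l : Comp r n) (x y : Fin r) (h : row l x = row l y) :
    ∃ i : ℕ, (rotation l ^ i) x = y := by
  obtain ⟨⟨j, a⟩, rfl⟩ := (cell l).surjective x
  obtain ⟨⟨j', b⟩, rfl⟩ := (cell l).surjective y
  obtain rfl : j = j' := by simpa only [row_cell] using h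
  obtain ⟨i, hi⟩ := exists_finRotate_pow_eq a b
  exact ⟨i, by rw [rotation_pow_cell, hi]⟩

theorem rotation_pow_eq_one {l : Comp r n} {p : ℕ} [hp : Fact p.Prime] (hl : IsPPartition p l) :
    rotation l ^ p ^ r = 1 := by
  refine Equiv.ext ((cell l).surjective.forall.2 ?_)
  rintro ⟨j, a⟩
  have hle : l.1 j ≤ r :=
    (Finset.single_le_sum (fun _ _ => Nat.zero_le _) (Finset.mem_univ j)).trans l.2.le
  obtain ⟨t, ht⟩ : ∃ t, l.1 j = p ^ t := (hl.2 j).resolve_left a.pos.ne'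
  have htr : t ≤ r := (Nat.lt_pow_self hp.out.one_lt).le.trans (ht ▸ hle)
  obtain ⟨q, hq⟩ : l.1 j ∣ p ^ r := ht ▸ pow_dvd_pow p htr
  rw [rotation_pow_cell, hq, pow_mul, finRotate_pow_self, one_pow]
  rfl

end Rotation

section Colourings

variable {r n : ℕ} {T : Type*} {c : Fin r → T} {α β : PT r} {σ : Equiv.Perm (Fin r)}

/-- The number of points of colour `t` which `α` maps to `v`. -/
noncomputable def colourCount (c : Fin r → T) (α : PT r) (t : T) (v : Fin (r + 1)) : ℕ :=
  Nat.card {x : Fin r // c x = t ∧ α.app x.succ = v}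

theorem exists_mem_colourYoung_iff :
    (∃ π ∈ colourYoung c, β = α * permHom r π) ↔
      ∀ t v, colourCount c β t v = colourCount c α t v := by
  constructor
  · rintro ⟨π, hπ, rfl⟩ t v
    refine Nat.card_congr (π.subtypeEquiv fun x => ?_)
    rw [hπ x, PT.mul_app, permHom_app_succ]
  · intro h
    obtain ⟨π, hπ⟩ := exists_perm_comp_eq (fun x : Fin r => (c x, β.app x.succ))
      (fun x : Fin r => (c x, α.app x.succ)) (by
        rintro ⟨t, v⟩
        simpa only [colourCount, Prod.mk.injEq] using h t v)
    exact ⟨π, fun x => congrArg Prod.fst (hπ x),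
      PT.ext_succ fun x => (congrArg Prod.snd (hπ x)).symm⟩

theorem colourCount_permHom_mul (σ : Equiv.Perm (Fin r)) (t : T) (v : Fin (r + 1)) :
    colourCount c (permHom r σ * α) t ((permHom r σ).app v) = colourCount c α t v := by
  simp only [colourCount, PT.mul_app, (permHom_app_injective σ).eq_iff]

theorem exists_mem_colourYoung_comm_iff :
    (∃ π ∈ colourYoung c, permHom r σ * α = α * permHom r π) ↔
      ∀ t x, colourCount c α t (σ x).succ = colourCount c α t x.succ := by
  have hsurj := Finite.injective_iff_surjective.1 (permHom_app_injective σ)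
  rw [exists_mem_colourYoung_iff]
  refine forall_congr' fun t => ?_
  rw [hsurj.forall]
  simp only [colourCount_permHom_mul, Fin.forall_fin_succ, PT.app_zero,
    permHom_app_succ, true_and]
  exact forall_congr' fun _ => eq_comm

theorem isStable_colourYoung_iff {H : Subgroup (Equiv.Perm (Fin r))} :
    IsStable H (colourYoung c) α ↔
      ∀ σ ∈ H, ∀ t x, colourCount c α t (σ x).succ = colourCount c α t x.succ :=
  forall₂_congr fun _ _ => exists_mem_colourYoung_comm_iff

theorem exists_fiber_rank {X : Type*} [Finite X] (F : X → T) : ∃ rank : X → ℕ,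
    (∀ x y, F x = F y → rank x = rank y → x = y) ∧
    ∀ t s, Nat.card {x // F x = t ∧ rank x = s} =
      Nat.card {b : Fin (Nat.card {x // F x = t}) // b.val = s} := by
  let e : ∀ t, {x // F x = t} ≃ Fin (Nat.card {x // F x = t}) := fun t => Finite.equivFin _
  let rank : X → ℕ := fun x => e (F x) ⟨x, rfl⟩
  have hrank : ∀ t (x : {x // F x = t}), rank x.1 = e t x := by
    rintro _ ⟨x, rfl⟩
    rfl
  refine ⟨rank, fun x y hF h => ?_, fun t s => ?_⟩
  · rw [hrank (F x) ⟨x, rfl⟩, hrank (F x) ⟨y, hF.symm⟩] at h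
    exact congrArg Subtype.val ((e _).injective (Fin.ext h))
  · refine Nat.card_congr ((Equiv.subtypeSubtypeEquivSubtypeInter _ _).symm.trans
      ((e t).subtypeEquiv fun x => ?_))
    rw [hrank]

theorem IsStable.exists_rank {H : Subgroup (Equiv.Perm (Fin r))}
    (hα : IsStable H (colourYoung c) α) : ∃ rank : Fin r → ℕ,
    (∀ x y, c x = c y → α.app x.succ = α.app y.succ → rank x = rank y → x = y) ∧
    IsStable H (colourYoung fun x => (c x, rank x)) α := by
  obtain ⟨rank, hinj, hcard⟩ := exists_fiber_rank fun x : Fin r => (c x, α.app x.succ)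
  have hcount : ∀ t s v, colourCount (fun x => (c x, rank x)) α (t, s) v =
      Nat.card {b : Fin (colourCount c α t v) // b.val = s} := fun t s v => by
    have hfib : colourCount c α t v = Nat.card {x : Fin r // (c x, α.app x.succ) = (t, v)} := by
      simp only [colourCount, Prod.mk.injEq]
    rw [hfib, ← hcard]
    simp only [colourCount, Prod.mk.injEq, and_right_comm]
  refine ⟨rank, fun x y hc he => hinj x y (Prod.ext hc he), isStable_colourYoung_iff.2 ?_⟩
  rintro σ hσ ⟨t, s⟩ x
  rw [hcount, hcount, isStable_colourYoung_iff.1 hα σ hσ]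

end Colourings

section RowMaps

variable {r n : ℕ} {l : Comp r n} {α β : PT r}

/-- The row containing `v`, or `none` if `v = 0`. -/
def imageRow (l : Comp r n) (v : Fin (r + 1)) : Option (Fin n) :=
  Fin.cases (motive := fun _ => Option (Fin n)) none (fun u => some (row l u)) v

@[simp] theorem imageRow_zero (l : Comp r n) : imageRow l 0 = none := rfl

@[simp] theorem imageRow_succ (l : Comp r n) (u : Fin r) :
    imageRow l u.succ = some (row l u) := rfl

theorem imageRow_eq_none {v : Fin (r + 1)} : imageRow l v = none ↔ v = 0 := by
  induction v using Fin.cases <;> simp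

theorem imageRow_eq_some {v : Fin (r + 1)} {j : Fin n} :
    imageRow l v = some j ↔ ∃ u : Fin r, v = u.succ ∧ row l u = j := by
  induction v using Fin.cases <;> simp [(Fin.succ_ne_zero _).symm]

theorem imageRow_permHom {σ : Equiv.Perm (Fin r)} (hσ : σ ∈ young l) (v : Fin (r + 1)) :
    imageRow l ((permHom r σ).app v) = imageRow l v := by
  induction v using Fin.cases with
  | zero => rw [PT.app_zero]
  | succ u => rw [permHom_app_succ, imageRow_succ, imageRow_succ, hσ u]

/-- `α` maps every row either to `0` or bijectively onto a row. -/
structure IsRowMap (l : Comp r n) (α : PT r) : Prop where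
  inj : ∀ x y : Fin r, row l x = row l y → α.app x.succ = α.app y.succ → α.app x.succ ≠ 0 → x = y
  surj : ∀ x u u' : Fin r, α.app x.succ = u.succ → row l u = row l u' →
    ∃ x', row l x' = row l x ∧ α.app x'.succ = u'.succ
  imageRow_eq : ∀ x y : Fin r, row l x = row l y →
    imageRow l (α.app x.succ) = imageRow l (α.app y.succ)

theorem IsRowMap.colourCount_succ_le (hα : IsRowMap l α) {u u' : Fin r} {j : Fin n}
    (h : ∀ x : Fin r, row l x = j → α.app x.succ = u.succ →
      ∃ y, row l y = j ∧ β.app y.succ = u'.succ) :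
    colourCount (row l) α j u.succ ≤ colourCount (row l) β j u'.succ := by
  have hsub : Subsingleton {x : Fin r // row l x = j ∧ α.app x.succ = u.succ} :=
    ⟨fun x y => Subtype.ext (hα.inj _ _ (x.2.1.trans y.2.1.symm) (x.2.2.trans y.2.2.symm)
      (x.2.2.trans_ne (Fin.succ_ne_zero u)))⟩
  choose t ht using fun x : {x : Fin r // row l x = j ∧ α.app x.succ = u.succ} => h x.1 x.2.1 x.2.2
  exact Nat.card_le_card_of_injective (fun x => ⟨t x, ht x⟩) fun _ _ _ => Subsingleton.elim _ _

theorem IsRowMap.isStable (hα : IsRowMap l α) : IsStable (young l) (young l) α := by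
  have hle : ∀ (u u' : Fin r) (j : Fin n), row l u = row l u' →
      colourCount (row l) α j u.succ ≤ colourCount (row l) α j u'.succ := fun u u' j huu' =>
    hα.colourCount_succ_le fun x hx hu =>
      (hα.surj x u u' hu huu').imp fun _ h => ⟨h.1.trans hx, h.2⟩
  exact isStable_colourYoung_iff.2 fun σ hσ j x =>
    (hle _ _ j (hσ x)).antisymm (hle _ _ j (hσ x).symm)

theorem IsRowMap.exists_young (hα : IsRowMap l α) (hβ : IsRowMap l β)
    (h : ∀ x : Fin r, imageRow l (β.app x.succ) = imageRow l (α.app x.succ)) :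
    ∃ π ∈ young l, β = α * permHom r π := by
  have hle : ∀ {α β : PT r}, IsRowMap l α → IsRowMap l β →
      (∀ x : Fin r, imageRow l (β.app x.succ) = imageRow l (α.app x.succ)) →
      ∀ (j : Fin n) (u : Fin r),
        colourCount (row l) α j u.succ ≤ colourCount (row l) β j u.succ := by
    intro α β hα hβ h j u
    refine hα.colourCount_succ_le fun x hx hu => ?_
    obtain ⟨w, hw, hwu⟩ := imageRow_eq_some.1 ((h x).trans (hu ▸ imageRow_succ l u))
    exact (hβ.surj x w u hw hwu).imp fun _ h => ⟨h.1.trans hx, h.2⟩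
  refine exists_mem_colourYoung_iff.2 fun j => Fin.forall_fin_succ.2 ⟨?_, fun u =>
    (hle hβ hα (fun x => (h x).symm) j u).antisymm (hle hα hβ h j u)⟩
  simp only [colourCount, ← imageRow_eq_none (l := l), h]

theorem IsRowMap.row_len_eq (hα : IsRowMap l α) {x u : Fin r} (hx : α.app x.succ = u.succ) :
    l.1 (row l x) = l.1 (row l u) := by
  rw [← card_row, ← card_row]
  apply le_antisymm
  · have himg : ∀ y : {y : Fin r // row l y = row l x}, ∃ w : {w : Fin r // row l w = row l u},
        α.app y.1.succ = w.1.succ := fun y => by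
      obtain ⟨w, hw, hwu⟩ := imageRow_eq_some.1
        ((hα.imageRow_eq y x y.2).trans (hx ▸ imageRow_succ l u))
      exact ⟨⟨w, hwu⟩, hw⟩
    choose t ht using himg
    refine Nat.card_le_card_of_injective t fun a b hab => Subtype.ext ?_
    exact hα.inj _ _ (a.2.trans b.2.symm) (by rw [ht, ht, hab]) (ht a ▸ Fin.succ_ne_zero _)
  · choose t ht ht' using fun w : {w : Fin r // row l w = row l u} => hα.surj x u w hx w.2.symm
    refine Nat.card_le_card_of_injective (fun w => ⟨t w, ht w⟩) fun a b hab => Subtype.ext ?_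
    exact Fin.succ_injective _ (by rw [← ht', ← ht', Subtype.mk_eq_mk.1 hab])

/-- The idempotent which maps row `j` to `0` and fixes all other points. -/
def killRow (l : Comp r n) (j : Fin n) : PT r :=
  PT.mk fun x => if row l x = j then 0 else x.succ

theorem killRow_app_succ (l : Comp r n) (j : Fin n) (x : Fin r) :
    (killRow l j).app x.succ = if row l x = j then 0 else x.succ := PT.mk_app_succ _ _

theorem killRow_mem_rook (l : Comp r n) (j : Fin n) : killRow l j ∈ rook r :=
  mem_rook_of_succ fun x y => by
    simp only [killRow_app_succ]
    split_ifs <;> simp [(Fin.succ_ne_zero _).symm]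

theorem isStable_killRow (l : Comp r n) (j : Fin n) : IsStable (young l) (young l) (killRow l j) :=
  fun σ hσ => ⟨σ, hσ, PT.ext_succ fun x => by
    simp only [PT.mul_app, permHom_app_succ, killRow_app_succ, hσ x]
    split_ifs <;> simp⟩

theorem killRow_mul {j : Fin n} (h : ∀ x u : Fin r, α.app x.succ = u.succ → row l u ≠ j) :
    killRow l j * α = α := by
  refine PT.ext_succ fun x => ?_
  rw [PT.mul_app]
  rcases Fin.eq_zero_or_eq_succ (α.app x.succ) with h0 | ⟨u, hu⟩
  · rw [h0, PT.app_zero]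
  · rw [hu, killRow_app_succ, if_neg (h x u hu)]

end RowMaps

namespace RSchur

variable {k : Type*} [CommRing k] {r n : ℕ} {S : TransMonoid r} {l : Comp r n} {α : S.Elt}

theorem f_mul_f_of_isStable_young {β : S.Elt} (hα : IsStable (young l) (young l) α.1)
    (hβ : IsStable (young l) (young l) β.1) :
    f k S l l α * f k S l l β = f k S l l (α * β) := by
  have hαβ : IsStable (young l) (young l) (α * β).1 := hα.mul hβ
  exact f_mul_f_of_isStable hβ (hαβ.nR_eq.trans hα.nR_eq.symm)

theorem isStable_of_f_notMem_eIdeal (hn : r ≤ n) (h : f k S l l α ∉ eIdeal k S l) :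
    IsStable (young l) (young l) α.1 := by
  let d : Fin r → Fin n → ℕ := fun x j => colourCount (row l) α.1 j x.succ
  have hGR : GR l l α = young l ⊓ colourYoung d := by
    ext σ
    refine mem_GR_iff.trans (and_congr_right' (exists_mem_colourYoung_comm_iff.trans ?_))
    exact forall_comm.trans (forall_congr' fun _ => funext_iff.symm)
  contrapose! h
  refine f_mem_eIdeal_of_GR_eq hn ?_ hGR
  by_contra! hd
  exact h fun σ hσ => (mem_GR_iff.1 (hGR ▸ ⟨hσ, fun x => hd _ _ (hσ x)⟩ : σ ∈ GR l l α)).2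

theorem imageRow_eq_of_f_notMem_eIdeal (hn : r ≤ n) (h : f k S l l α ∉ eIdeal k S l) {x y : Fin r}
    (hxy : row l x = row l y) : imageRow l (α.1.app x.succ) = imageRow l (α.1.app y.succ) := by
  have hst := isStable_of_f_notMem_eIdeal hn h
  contrapose! h
  refine f_mem_eIdeal_of_isStable hn (d := fun x => imageRow l (α.1.app x.succ))
    ⟨x, y, hxy, h⟩ fun σ hσ => ?_
  obtain ⟨π, hπ, hσα⟩ := hst σ hσ
  refine ⟨π, ⟨hπ, fun z => ?_⟩, hσα⟩
  beta_reduce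
  rw [← permHom_app_succ, ← PT.mul_app, ← hσα, PT.mul_app, imageRow_permHom hσ]

theorem eq_of_f_notMem_eIdeal (hn : r ≤ n) (h : f k S l l α ∉ eIdeal k S l) {x y : Fin r}
    (hxy : row l x = row l y) (he : α.1.app x.succ = α.1.app y.succ) : x = y := by
  have hst := isStable_of_f_notMem_eIdeal hn h
  contrapose! h
  obtain ⟨rank, hinj, hrank⟩ := IsStable.exists_rank (c := row l) hst
  exact f_mem_eIdeal_of_isStable hn ⟨x, y, hxy, mt (hinj x y hxy he) h⟩
    (hrank.mono_right fun _ => mem_young_inf_colourYoung.2)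

theorem isRowMap_of_f_notMem_eIdeal (hn : r ≤ n) (h : f k S l l α ∉ eIdeal k S l) :
    IsRowMap l α.1 where
  inj _ _ hxy he _ := eq_of_f_notMem_eIdeal hn h hxy he
  imageRow_eq _ _ := imageRow_eq_of_f_notMem_eIdeal hn h
  surj x u u' hu huu' := by
    obtain ⟨π, hπ, hα⟩ := isStable_of_f_notMem_eIdeal hn h _ (swap_mem_young huu')
    refine ⟨π x, hπ x, ?_⟩
    rw [← permHom_app_succ, ← PT.mul_app, ← hα, PT.mul_app, hu, permHom_app_succ,
      Equiv.swap_apply_left]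

theorem f_killRow_mem_eIdeal (hn : r ≤ n) {j : Fin n} (hj : 1 < l.1 j)
    (hS : killRow l j ∈ S.toSubmonoid) : f k S l l ⟨killRow l j, hS⟩ ∈ eIdeal k S l := by
  rw [← card_row, Finite.one_lt_card_iff_nontrivial] at hj
  obtain ⟨⟨x, hx⟩, ⟨y, hy⟩, hne⟩ := hj
  by_contra h
  refine hne (Subtype.ext (eq_of_f_notMem_eIdeal hn h (hx.trans hy.symm) ?_))
  rw [killRow_app_succ, killRow_app_succ, if_pos hx, if_pos hy]

theorem hitsLargeRows_of_f_notMem_eIdeal (hn : r ≤ n) (hS : rook r ≤ S.toSubmonoid)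
    (h : f k S l l α ∉ eIdeal k S l) : HitsLargeRows l α.1 := by
  have hα := isRowMap_of_f_notMem_eIdeal hn h
  intro x hx
  contrapose! h
  let η : S.Elt := ⟨killRow l (row l x), hS (killRow_mem_rook _ _)⟩
  have hηα : η * α = α := Subtype.ext <| killRow_mul fun y u hu hux =>
    (hα.surj y u x hu hux).elim fun z hz => h z hz.2
  rw [← hηα, ← f_mul_f_of_isStable_young (isStable_killRow l _) hα.isStable]
  exact TwoSidedIdeal.mul_mem_right _ _ _ (f_killRow_mem_eIdeal hn hx _)

end RSchur

section Phi

variable {r n p : ℕ} {l : Comp r n} {i : ℕ}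

theorem nthRow_injective (i : ℕ) : Function.Injective fun a => (nthRow p l i a : Fin n) :=
  fun _ _ h => (Finset.orderIsoOfFin _ rfl).injective (Subtype.ext h)

/-- The row named by an element of `{0,…,s_i}`, or `none` for `0`. -/
def rowOfIndex (l : Comp r n) (i : ℕ) (w : Fin (mult p l i + 1)) : Option (Fin n) :=
  Fin.cases (motive := fun _ => Option (Fin n)) none (fun a => some (nthRow p l i a : Fin n)) w

@[simp] theorem rowOfIndex_zero : rowOfIndex (p := p) l i 0 = none := rfl

@[simp] theorem rowOfIndex_succ (a : Fin (mult p l i)) :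
    rowOfIndex l i a.succ = some (nthRow p l i a : Fin n) := rfl

theorem rowOfIndex_injective (i : ℕ) : Function.Injective (rowOfIndex (p := p) l i) := by
  intro v w
  cases v using Fin.cases <;> cases w using Fin.cases
  · exact fun _ => rfl
  · exact nofun
  · exact nofun
  · exact fun h => congrArg Fin.succ (nthRow_injective i (Option.some_injective _ h))

variable [hp : Fact p.Prime] (hl : IsPPartition p l)

theorem row_label (a : Fin (mult p l i)) (b : Fin (p ^ i)) :
    row l (label hl ⟨i, a, b⟩) = nthRow p l i a :=
  row_cell l _

theorem row_len_label (a : Fin (mult p l i)) (b : Fin (p ^ i)) :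
    l.1 (row l (label hl ⟨i, a, b⟩)) = p ^ i := by
  rw [row_label, nthRow_len]

theorem exists_label (x : Fin r) : ∃ i a b, label hl ⟨i, a, b⟩ = x := by
  obtain ⟨⟨i, a, b⟩, h⟩ := (label hl).surjective x
  exact ⟨i, a, b, h⟩

theorem exists_label_of_row_len_eq {x : Fin r} (h : l.1 (row l x) = p ^ i) :
    ∃ a b, label hl ⟨i, a, b⟩ = x := by
  obtain ⟨j, a, b, rfl⟩ := exists_label hl x
  rw [row_len_label] at h
  obtain rfl := Nat.pow_right_injective hp.out.two_le h
  exact ⟨a, b, rfl⟩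

theorem exists_label_of_row_eq {x : Fin r} {a : Fin (mult p l i)} (h : row l x = nthRow p l i a) :
    ∃ b, label hl ⟨i, a, b⟩ = x := by
  obtain ⟨a', b, rfl⟩ := exists_label_of_row_len_eq hl (h ▸ nthRow_len p l i a)
  rw [row_label] at h
  exact ⟨b, by rw [nthRow_injective i h]⟩

theorem exists_label_of_row_eq_row {x y : Fin r} (h : row l x = row l y) :
    ∃ i a b c, label hl ⟨i, a, b⟩ = x ∧ label hl ⟨i, a, c⟩ = y := by
  obtain ⟨i, a, b, rfl⟩ := exists_label hl x
  obtain ⟨c, hc⟩ := exists_label_of_row_eq hl (h.symm.trans (row_label hl a b))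
  exact ⟨i, a, b, c, rfl, hc⟩

variable {hl} {A B : ∀ i, PT (mult p l i)} {a : Fin (mult p l i)} {b : Fin (p ^ i)}

theorem phi_app_label :
    (phi hl A).app (label hl ⟨i, a, b⟩).succ =
      Fin.cases (motive := fun _ => Fin (r + 1)) 0 (fun a' => (label hl ⟨i, a', b⟩).succ)
        ((A i).app a.succ) :=
  congrArg (fun y : Σ i : ℕ, Fin (mult p l i) × Fin (p ^ i) =>
    Fin.cases (motive := fun _ => Fin (r + 1)) 0 (fun a' => (label hl ⟨y.1, a', y.2.2⟩).succ)
      ((A y.1).app y.2.1.succ)) ((label hl).symm_apply_apply ⟨i, a, b⟩)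

theorem phi_app_label_eq_succ_iff {u : Fin r} :
    (phi hl A).app (label hl ⟨i, a, b⟩).succ = u.succ ↔
      ∃ a', (A i).app a.succ = a'.succ ∧ label hl ⟨i, a', b⟩ = u := by
  rw [phi_app_label]
  cases (A i).app a.succ using Fin.cases <;> simp [(Fin.succ_ne_zero _).symm]

theorem imageRow_phi : imageRow l ((phi hl A).app (label hl ⟨i, a, b⟩).succ) =
    rowOfIndex l i ((A i).app a.succ) := by
  rw [phi_app_label]
  cases (A i).app a.succ using Fin.cases with
  | zero => rfl
  | succ w => rw [Fin.cases_succ, imageRow_succ, row_label, rowOfIndex_succ]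

theorem exists_of_phi_app_eq {x y u : Fin r} (hx : (phi hl A).app x.succ = u.succ)
    (hy : (phi hl A).app y.succ = u.succ) :
    ∃ (i : ℕ) (a a' w : Fin (mult p l i)) (b : Fin (p ^ i)), label hl ⟨i, a, b⟩ = x ∧
      label hl ⟨i, a', b⟩ = y ∧ (A i).app a.succ = w.succ ∧ (A i).app a'.succ = w.succ := by
  obtain ⟨i, a, b, rfl⟩ := exists_label hl x
  obtain ⟨j, a', b', rfl⟩ := exists_label hl y
  obtain ⟨w, hw, rfl⟩ := phi_app_label_eq_succ_iff.1 hx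
  obtain ⟨w', hw', he⟩ := phi_app_label_eq_succ_iff.1 hy
  obtain ⟨rfl, he⟩ := Sigma.mk.inj_iff.1 ((label hl).injective he)
  obtain ⟨rfl, rfl⟩ := Prod.mk_inj.1 (eq_of_heq he)
  exact ⟨j, a, a', w', b', rfl, rfl, hw, hw'⟩

theorem isRowMap_phi (hl : IsPPartition p l) (A : ∀ i, PT (mult p l i)) :
    IsRowMap l (phi hl A) where
  inj x y hxy he h0 := by
    obtain ⟨u, hu⟩ := Fin.exists_succ_eq.2 h0
    obtain ⟨i, a, a', -, b, rfl, rfl, -⟩ := exists_of_phi_app_eq hu.symm (he.symm.trans hu.symm)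
    rw [row_label, row_label] at hxy
    rw [nthRow_injective i hxy]
  surj x u u' hu huu' := by
    obtain ⟨i, a, b, rfl⟩ := exists_label hl x
    obtain ⟨a', ha', rfl⟩ := phi_app_label_eq_succ_iff.1 hu
    obtain ⟨b', rfl⟩ := exists_label_of_row_eq hl (huu'.symm.trans (row_label hl a' b))
    exact ⟨label hl ⟨i, a, b'⟩, by rw [row_label, row_label],
      phi_app_label_eq_succ_iff.2 ⟨a', ha', rfl⟩⟩
  imageRow_eq x y hxy := by
    obtain ⟨i, a, b, c, rfl, rfl⟩ := exists_label_of_row_eq_row hl hxy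
    rw [imageRow_phi, imageRow_phi]

theorem eq_of_imageRow_phi_eq (h : ∀ x : Fin r,
    imageRow l ((phi hl A).app x.succ) = imageRow l ((phi hl B).app x.succ)) : A = B := by
  refine funext fun i => PT.ext_succ fun a => rowOfIndex_injective i ?_
  have b : Fin (p ^ i) := ⟨0, pow_pos hp.out.pos i⟩
  rw [← imageRow_phi (hl := hl) (b := b), h, imageRow_phi]

theorem phi_injective (hl : IsPPartition p l) : Function.Injective (phi hl) := fun _ _ h =>
  eq_of_imageRow_phi_eq fun _ => by rw [h]

theorem eq_of_dc_eq_of_phi {S : TransMonoid r} {α β : S.Elt} (hα : phi hl A = α.1)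
    (hβ : phi hl B = β.1) (h : dc S l l α = dc S l l β) : A = B := by
  obtain ⟨σ, hσ, π, hπ, rfl⟩ := dc_eq_iff.1 h
  refine eq_of_imageRow_phi_eq fun x => ((isRowMap_phi hl A).imageRow_eq _ _ (hπ x).symm).trans ?_
  rw [hβ, hα]
  exact (imageRow_permHom hσ _).symm

theorem phi_mem_rook (hA : ∀ i, A i ∈ rook (mult p l i)) : phi hl A ∈ rook r := by
  refine mem_rook_of_succ fun x y he h0 => ?_
  obtain ⟨u, hu⟩ := Fin.exists_succ_eq.2 h0
  obtain ⟨i, a, a', w, b, rfl, rfl, ha, ha'⟩ :=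
    exists_of_phi_app_eq hu.symm (he.symm.trans hu.symm)
  rw [Fin.succ_injective _ (hA i w.succ (Fin.succ_ne_zero w) _ _ ha ha')]

theorem hitsLargeRows_phi_iff :
    HitsLargeRows l (phi hl A) ↔ ∀ i, 0 < i → A i ∈ symSub (mult p l i) := by
  constructor
  · refine fun h i hi => mem_symSub_of_surj fun a => ?_
    have b : Fin (p ^ i) := ⟨0, pow_pos hp.out.pos i⟩
    obtain ⟨z, hz⟩ := h (label hl ⟨i, a, b⟩)
      (by rw [row_len_label]; exact Nat.one_lt_pow hi.ne' hp.out.one_lt)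
    obtain ⟨j, c, d, rfl⟩ := exists_label hl z
    obtain ⟨c', hc, he⟩ := phi_app_label_eq_succ_iff.1 hz
    obtain ⟨rfl, he⟩ := Sigma.mk.inj_iff.1 ((label hl).injective he)
    exact ⟨c, hc.trans (congrArg Fin.succ (Prod.mk_inj.1 (eq_of_heq he)).1)⟩
  · intro h x hx
    obtain ⟨i, a, b, rfl⟩ := exists_label hl x
    rw [row_len_label] at hx
    have hi : 0 < i := Nat.pos_of_ne_zero fun h0 => by simp [h0] at hx
    obtain ⟨σ, hσ⟩ := h i hi
    refine ⟨label hl ⟨i, σ⁻¹ a, b⟩, phi_app_label_eq_succ_iff.2 ⟨a, ?_, rfl⟩⟩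
    simp [← hσ, permHom_app_succ]

theorem IsRowMap.exists_rowOfIndex_eq {α : PT r} (hα : IsRowMap l α) (hl : IsPPartition p l)
    (i : ℕ) (a : Fin (mult p l i)) : ∃ w : Fin (mult p l i + 1), ∀ b : Fin (p ^ i),
      rowOfIndex l i w = imageRow l (α.app (label hl ⟨i, a, b⟩).succ) := by
  have b₀ : Fin (p ^ i) := ⟨0, pow_pos hp.out.pos i⟩
  suffices h : ∃ w : Fin (mult p l i + 1),
      rowOfIndex l i w = imageRow l (α.app (label hl ⟨i, a, b₀⟩).succ) from
    h.imp fun w hw b => hw.trans (hα.imageRow_eq _ _ (by rw [row_label, row_label]))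
  rcases Fin.eq_zero_or_eq_succ (α.app (label hl ⟨i, a, b₀⟩).succ) with h | ⟨u, hu⟩
  · exact ⟨0, by rw [h, imageRow_zero, rowOfIndex_zero]⟩
  · obtain ⟨a', b', rfl⟩ := exists_label_of_row_len_eq hl
      ((hα.row_len_eq hu).symm.trans (row_len_label hl a b₀))
    exact ⟨a'.succ, by rw [hu, imageRow_succ, row_label, rowOfIndex_succ]⟩

theorem IsRowMap.exists_phi_eq {α : PT r} (hα : IsRowMap l α) (hl : IsPPartition p l) :
    ∃ A : ∀ i, PT (mult p l i), ∃ π ∈ young l, phi hl A = α * permHom r π := by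
  choose w hw using hα.exists_rowOfIndex_eq hl
  refine ⟨fun i => PT.mk (w i), hα.exists_young (isRowMap_phi hl _) fun x => ?_⟩
  obtain ⟨i, a, b, rfl⟩ := exists_label hl x
  rw [imageRow_phi, PT.mk_app_succ, hw]

theorem IsRowMap.exists_mem_prodSub {α : PT r} (hα : IsRowMap l α) (hh : HitsLargeRows l α)
    (hl : IsPPartition p l) :
    ∃ A ∈ prodSub (p := p) l ⊤, ∃ π ∈ young l, phi hl A = α * permHom r π := by
  obtain ⟨A, π, hπ, hA⟩ := hα.exists_phi_eq hl
  have hit : HitsLargeRows l (phi hl A) := fun x hx => by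
    obtain ⟨z, hz⟩ := hh x hx
    exact ⟨π⁻¹ z, by simp [hA, PT.mul_app, permHom_app_succ, hz]⟩
  exact ⟨A, ⟨trivial, hitsLargeRows_phi_iff.1 hit⟩, π, hπ, hA⟩

end Phi

section Isomorphism

variable (k : Type*) [CommRing k] {r n p : ℕ} [hp : Fact p.Prime] {l : Comp r n}
  {S : TransMonoid r} {hl : IsPPartition p l}

/-- An element of `S'` as an element of `S_r`. -/
def sprimeElt (γ : Sprime hl S) : S.Elt := ⟨γ.1, γ.2.2.2⟩

theorem isRowMap_sprimeElt (γ : Sprime hl S) : IsRowMap l (sprimeElt γ).1 := by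
  obtain ⟨A, -, hA⟩ := γ.2.1
  exact hA ▸ isRowMap_phi hl A

theorem hitsLargeRows_sprimeElt (γ : Sprime hl S) : HitsLargeRows l (sprimeElt γ).1 := by
  obtain ⟨A, hA', hA⟩ := γ.2.1
  exact hA ▸ hitsLargeRows_phi_iff.2 hA'.2

theorem dc_sprimeElt_injective :
    Function.Injective fun γ : Sprime hl S => dc S l l (sprimeElt γ) := by
  intro γ δ h
  obtain ⟨A, -, hA⟩ := γ.2.1
  obtain ⟨B, -, hB⟩ := δ.2.1
  have hAB : A = B := eq_of_dc_eq_of_phi (α := sprimeElt γ) (β := sprimeElt δ) hA hB h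
  exact Subtype.ext (by rw [← hA, ← hB, hAB])

variable (S hl) in
/-- The multiplicative map `S' → C_R^λ`, `α ↦ Π_R (f(λ,α,λ))`. -/
noncomputable def sprimeToCR : Sprime hl S →* CR k S l where
  toFun γ := projR k S l (fCorner k S l (sprimeElt γ))
  map_one' := map_one (projR k S l)
  map_mul' γ δ := by
    have h : fCorner k S l (sprimeElt (γ * δ)) =
        fCorner k S l (sprimeElt γ) * fCorner k S l (sprimeElt δ) :=
      Subtype.ext (RSchur.f_mul_f_of_isStable_young (isRowMap_sprimeElt γ).isStable
        (isRowMap_sprimeElt δ).isStable).symm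
    rw [h, map_mul]

variable (S hl) in
/-- The algebra homomorphism `k[S'] → C_R^λ` extending `sprimeToCR`. -/
noncomputable def sprimeAlgHom : MonoidAlgebra k (Sprime hl S) →ₐ[k] CR k S l :=
  MonoidAlgebra.lift k _ _ (sprimeToCR k S hl)

variable {k}

theorem sprimeAlgHom_single (γ : Sprime hl S) :
    sprimeAlgHom k S hl (MonoidAlgebra.single γ 1) = projR k S l (fCorner k S l (sprimeElt γ)) := by
  rw [sprimeAlgHom, MonoidAlgebra.lift_single, one_smul]
  rfl

theorem psi_inclS_single (γ : Sprime hl S) :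
    psi hl S k (inclS hl S k (MonoidAlgebra.single γ 1)) = fCorner k S l (sprimeElt γ) := by
  have h : inclS hl S k (MonoidAlgebra.single γ 1) =
      MonoidAlgebra.single (Submonoid.inclusion (Sprime_le hl S) γ) 1 :=
    MonoidAlgebra.mapDomain_single
  rw [h]
  change Finsupp.linearCombination k _ (Finsupp.single _ 1) = _
  rw [Finsupp.linearCombination_single, one_smul]
  rfl

theorem sprimeAlgHom_apply (x : MonoidAlgebra k (Sprime hl S)) :
    sprimeAlgHom k S hl x = projR k S l (psi hl S k (inclS hl S k x)) := by
  have h : (sprimeAlgHom k S hl).toLinearMap =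
      (projR k S l).toLinearMap ∘ₗ psi hl S k ∘ₗ (inclS hl S k).toLinearMap :=
    (MonoidAlgebra.basis _ k).ext fun γ => by
      simpa [psi_inclS_single] using sprimeAlgHom_single γ
  exact LinearMap.congr_fun h x

variable (k S) in
/-- The coordinate of an element of `B_R^λ` at a double coset. -/
def cornerCoord (D : DC S l l) : BCorner k S l →ₗ[k] k where
  toFun x := x.1 l l D
  map_add' _ _ := rfl
  map_smul' _ _ := rfl

theorem cornerCoord_fCorner (D : DC S l l) (α : S.Elt) :
    cornerCoord k S D (fCorner k S l α) = if D = dc S l l α then 1 else 0 :=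
  RSchur.f_coord_same α D

theorem cornerCoord_psi_inclS (x : MonoidAlgebra k (Sprime hl S)) (γ : Sprime hl S) :
    cornerCoord k S (dc S l l (sprimeElt γ)) (psi hl S k (inclS hl S k x)) = x.coeff γ := by
  classical
  have h : cornerCoord k S (dc S l l (sprimeElt γ)) ∘ₗ psi hl S k ∘ₗ (inclS hl S k).toLinearMap =
      (MonoidAlgebra.basis (Sprime hl S) k).coord γ :=
    (MonoidAlgebra.basis _ k).ext fun δ => by
      rw [Module.Basis.coord_apply, Module.Basis.repr_self, Finsupp.single_apply, eq_comm]
      simp [psi_inclS_single, cornerCoord_fCorner, dc_sprimeElt_injective.eq_iff, eq_comm]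
  exact LinearMap.congr_fun h x

theorem sprimeAlgHom_injective [CharP k p] : Function.Injective (sprimeAlgHom k S hl) := by
  rw [injective_iff_map_eq_zero]
  intro x hx
  rw [sprimeAlgHom_apply] at hx
  have hmem : (psi hl S k (inclS hl S k x)).1 ∈ RSchur.eIdeal k S l :=
    Ideal.Quotient.eq_zero_iff_mem.1 hx
  refine MonoidAlgebra.ext (Finsupp.ext fun γ => ?_)
  rw [← cornerCoord_psi_inclS]
  exact RSchur.coord_eq_zero_of_mem_eIdeal (p := p) (fun v hv => prime_dvd_structConst
    (rotation_mem_young l) (rotation_pow_eq_one hl) (exists_rotation_pow_eq l)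
    (isRowMap_sprimeElt γ).isStable (hitsLargeRows_sprimeElt γ) hv) hmem

theorem corner_coord_eq_zero (x : BCorner k S l) {a b : Comp r n} (h : a ≠ l ∨ b ≠ l)
    (D : DC S a b) : x.1 a b D = 0 := by
  obtain ⟨hleft, hright⟩ := (Subsemigroup.mem_corner_iff (isIdempotentElem_f k S l)).1 x.2
  rcases h with h | h
  · rw [← hleft, RSchur.f_mul_coord_ne _ h]
  · rw [← hright, RSchur.mul_f_coord_ne _ h]

theorem corner_ext {x y : BCorner k S l} (h : ∀ D, cornerCoord k S D x = cornerCoord k S D y) :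
    x = y := by
  refine Subtype.ext (RSchur.ext fun a b D => ?_)
  by_cases hab : a ≠ l ∨ b ≠ l
  · rw [corner_coord_eq_zero x hab, corner_coord_eq_zero y hab]
  · obtain ⟨rfl, rfl⟩ : a = l ∧ b = l := by tauto
    exact h D

theorem span_range_fCorner : Submodule.span k (Set.range (fCorner k S l)) = ⊤ := by
  refine Submodule.eq_top_iff'.2 fun x => ?_
  choose rep hrep using (DC.ind fun α => ⟨α, rfl⟩ : ∀ D : DC S l l, ∃ α, dc S l l α = D)
  have hx : x = ∑ D, cornerCoord k S D x • fCorner k S l (rep D) :=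
    corner_ext fun E => by simp [cornerCoord_fCorner, hrep]
  rw [hx]
  exact sum_mem fun D _ => Submodule.smul_mem _ _ (Submodule.subset_span ⟨rep D, rfl⟩)

theorem projR_fCorner_mem_range (hn : r ≤ n) (hS : rook r ≤ S.toSubmonoid) (α : S.Elt) :
    projR k S l (fCorner k S l α) ∈ (sprimeAlgHom k S hl).range := by
  by_cases hα : RSchur.f k S l l α ∈ RSchur.eIdeal k S l
  · rw [show projR k S l (fCorner k S l α) = 0 from Ideal.Quotient.eq_zero_iff_mem.2 hα]
    exact zero_mem _
  · obtain ⟨A, hA, π, hπ, hγ⟩ := (RSchur.isRowMap_of_f_notMem_eIdeal hn hα).exists_mem_prodSub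
      (RSchur.hitsLargeRows_of_f_notMem_eIdeal hn hS hα) hl
    have hmem : (α * S.perm π).1 ∈ Sprime hl S := ⟨⟨A, hA, hγ⟩, ⟨A, hγ⟩, (α * S.perm π).2⟩
    have hf : RSchur.f k S l l (α * S.perm π) = RSchur.f k S l l α := by
      rw [RSchur.f, RSchur.f, dc_mul_right _ hπ]
    exact ⟨_, (sprimeAlgHom_single ⟨_, hmem⟩).trans (congrArg _ (Subtype.ext hf))⟩

theorem sprimeAlgHom_surjective (hn : r ≤ n) (hS : rook r ≤ S.toSubmonoid) :
    Function.Surjective (sprimeAlgHom k S hl) := by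
  have hle : Submodule.span k (Set.range (fCorner k S l)) ≤
      (sprimeAlgHom k S hl).range.toSubmodule.comap (projR k S l).toLinearMap :=
    Submodule.span_le.2 (Set.range_subset_iff.2 (projR_fCorner_mem_range hn hS))
  intro y
  obtain ⟨x, rfl⟩ := Ideal.Quotient.mk_surjective y
  exact hle (span_range_fCorner (k := k) ▸ Submodule.mem_top : x ∈ _)

end Isomorphism

section Factorization

variable {r n p : ℕ} [hp : Fact p.Prime] {l : Comp r n} {hl : IsPPartition p l}
  {S : TransMonoid r}

variable (hl S) in
/-- The submonoid `S₀` of the elements of `τ̄_{s_0}` which lie in `S_r` when extended by the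
identity to the rows of length greater than `1`. -/
noncomputable def baseSub : Submonoid (PT (mult p l 0)) :=
  (S.toSubmonoid.comap (phi hl)).comap (MonoidHom.mulSingle (fun i => PT (mult p l i)) 0)

theorem mem_baseSub {α : PT (mult p l 0)} :
    α ∈ baseSub hl S ↔ phi hl (Pi.mulSingle 0 α) ∈ S.toSubmonoid := Iff.rfl

theorem rook_le_baseSub (hS : rook r ≤ S.toSubmonoid) : rook (mult p l 0) ≤ baseSub hl S := by
  refine fun α hα => mem_baseSub.2 (hS (phi_mem_rook fun i => ?_))
  rcases eq_or_ne i 0 with rfl | hi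
  · rwa [Pi.mulSingle_eq_same]
  · rw [Pi.mulSingle_eq_of_ne hi]
    exact one_mem _

theorem exists_eq_mulSingle_mul_permHom {s : ℕ → ℕ} {A : ∀ i, PT (s i)}
    (hA : ∀ i, 0 < i → A i ∈ symSub (s i)) :
    ∃ σ : ∀ i, Equiv.Perm (Fin (s i)), A = Pi.mulSingle 0 (A 0) * fun i => permHom _ (σ i) := by
  suffices h : ∀ i, ∃ σ : Equiv.Perm (Fin (s i)),
      A i = Pi.mulSingle (M := fun i => PT (s i)) 0 (A 0) i * permHom _ σ by
    choose σ hσ using h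
    exact ⟨σ, funext hσ⟩
  intro i
  rcases Nat.eq_zero_or_pos i with rfl | hi
  · exact ⟨1, by rw [map_one, mul_one, Pi.mulSingle_eq_same]⟩
  · obtain ⟨σ, hσ⟩ := hA i hi
    exact ⟨σ, by rw [Pi.mulSingle_eq_of_ne hi.ne', one_mul, hσ]⟩

theorem phi_mem_iff_mem_baseSub (hS : rook r ≤ S.toSubmonoid) {A : ∀ i, PT (mult p l i)}
    (hA : ∀ i, 0 < i → A i ∈ symSub (mult p l i)) :
    phi hl A ∈ S.toSubmonoid ↔ A 0 ∈ baseSub hl S := by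
  obtain ⟨σ, hσ⟩ := exists_eq_mulSingle_mul_permHom hA
  have hmem (τ : ∀ i, Equiv.Perm (Fin (mult p l i))) :
      phi hl (fun i => permHom _ (τ i)) ∈ S.toSubmonoid :=
    hS (phi_mem_rook fun i => permHom_mem_rook (τ i))
  have hσσ : ((fun i => permHom _ (σ i)) * fun i => permHom _ (σ i)⁻¹ :
      ∀ i, PT (mult p l i)) = 1 :=
    funext fun i => by simp [← map_mul]
  have hinv : A * (fun i => permHom _ (σ i)⁻¹) = Pi.mulSingle 0 (A 0) := by
    conv_lhs => rw [hσ, mul_assoc, hσσ, mul_one]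
  rw [mem_baseSub]
  constructor <;> intro h
  · rw [← hinv, map_mul]
    exact mul_mem h (hmem _)
  · rw [hσ, map_mul]
    exact mul_mem h (hmem _)

theorem Sprime_eq_map (hS : rook r ≤ S.toSubmonoid) :
    Sprime hl S = (prodSub l (baseSub hl S)).map (phi hl) := by
  ext γ
  constructor
  · rintro ⟨⟨A, hA, rfl⟩, -, hγ⟩
    exact ⟨A, ⟨(phi_mem_iff_mem_baseSub hS hA.2).1 hγ, hA.2⟩, rfl⟩
  · rintro ⟨A, hA, rfl⟩
    exact ⟨⟨A, ⟨trivial, hA.2⟩, rfl⟩, ⟨A, rfl⟩, (phi_mem_iff_mem_baseSub hS hA.2).2 hA.1⟩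

variable (p l) in
theorem finite_mult_pos : {i : ℕ | 0 < mult p l i}.Finite := by
  refine (Set.finite_Iic r).subset fun i hi => ?_
  have hlen : p ^ i ≤ r := calc
    p ^ i = l.1 (nthRow p l i ⟨0, hi⟩) := (nthRow_len p l i ⟨0, hi⟩).symm
    _ ≤ ∑ j, l.1 j := Finset.single_le_sum (fun _ _ => Nat.zero_le _) (Finset.mem_univ _)
    _ = r := l.2
  exact (Nat.lt_pow_self hp.out.one_lt).le.trans hlen

end Factorization

section ProductDecomposition

variable {r n p : ℕ} (l : Comp r n) (S₀ : Submonoid (PT (mult p l 0)))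

/-- The inclusion `S₀ × ∏ 𝔖_{s_i} → ∏ τ̄_{s_i}`, where the product of symmetric groups is over the
`i > 0` with `s_i > 0`. -/
def prodHom : S₀ × (∀ i : {i : ℕ // 0 < i ∧ 0 < mult p l i}, Equiv.Perm (Fin (mult p l i))) →*
    ∀ i, PT (mult p l i) :=
  MonoidHom.pi fun
    | 0 => S₀.subtype.comp (MonoidHom.fst _ _)
    | i + 1 => if h : 0 < mult p l (i + 1) then
        (permHom _).comp ((Pi.evalMonoidHom
          (fun i : {i : ℕ // 0 < i ∧ 0 < mult p l i} => Equiv.Perm (Fin (mult p l i)))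
          ⟨i + 1, i.succ_pos, h⟩).comp (MonoidHom.snd _ _)) else 1

variable {l S₀}

theorem prodHom_apply_pos (x) (i : {i : ℕ // 0 < i ∧ 0 < mult p l i}) :
    prodHom l S₀ x i.1 = permHom _ (x.2 i) := by
  obtain ⟨_ | i, hi, hm⟩ := i
  · exact absurd hi (lt_irrefl 0)
  · simp only [prodHom, MonoidHom.pi_apply]
    rw [dif_pos hm]
    rfl

theorem prodHom_injective : Function.Injective (prodHom l S₀) := fun x y h =>
  Prod.ext (Subtype.ext (congrFun h 0)) <| funext fun i => permHom_injective _ <| by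
    rw [← prodHom_apply_pos, ← prodHom_apply_pos, h]

theorem mrange_prodHom : MonoidHom.mrange (prodHom l S₀) = prodSub l S₀ := by
  have htriv {i : ℕ} (hm : ¬ 0 < mult p l i) : Subsingleton (PT (mult p l i)) := by
    rw [Nat.eq_zero_of_not_pos hm]
    infer_instance
  apply le_antisymm
  · rintro _ ⟨x, rfl⟩
    refine ⟨x.1.2, fun i hi => ?_⟩
    by_cases hm : 0 < mult p l i
    · exact ⟨_, (prodHom_apply_pos x ⟨i, hi, hm⟩).symm⟩
    · rw [(htriv hm).elim (prodHom l S₀ x i) 1]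
      exact one_mem _
  · intro A hA
    choose σ hσ using fun i : {i : ℕ // 0 < i ∧ 0 < mult p l i} => hA.2 i i.2.1
    refine ⟨(⟨A 0, hA.1⟩, σ), funext fun i => ?_⟩
    rcases Nat.eq_zero_or_pos i with rfl | hi
    · rfl
    by_cases hm : 0 < mult p l i
    · exact (prodHom_apply_pos _ ⟨i, hi, hm⟩).trans (hσ ⟨i, hi, hm⟩)
    · exact (htriv hm).elim _ _

variable (l S₀) in
/-- The isomorphism `S₀ × ∏ 𝔖_{s_i} ≅ S₀ · ∏ 𝔖_{s_i}`. -/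
noncomputable def prodEquiv :
    S₀ × (∀ i : {i : ℕ // 0 < i ∧ 0 < mult p l i}, Equiv.Perm (Fin (mult p l i))) ≃*
      prodSub l S₀ :=
  (MulEquiv.ofBijective (prodHom l S₀).mrangeRestrict
    ⟨fun _ _ h => prodHom_injective (congrArg Subtype.val h),
      MonoidHom.mrangeRestrict_surjective _⟩).trans (MulEquiv.submonoidCongr mrange_prodHom)

end ProductDecomposition

end GenSchur

theorem proposition8p4_general {r n p : ℕ} (hn : r ≤ n) [Fact p.Prime] (k : Type*) [CommRing k]
    [CharP k p] (S : GenSchur.TransMonoid r) (hS : GenSchur.rook r ≤ S.toSubmonoid)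
    (l : GenSchur.Comp r n) (hl : GenSchur.IsPPartition p l) :
    (∃ Φ : MonoidAlgebra k (GenSchur.Sprime hl S) ≃ₐ[k] GenSchur.CR k S l,
        ∀ x, Φ x = GenSchur.projR k S l (GenSchur.psi hl S k (GenSchur.inclS hl S k x))) ∧
    ∃ S₀ : Submonoid (GenSchur.PT (GenSchur.mult p l 0)),
      GenSchur.rook (GenSchur.mult p l 0) ≤ S₀ ∧
      GenSchur.Sprime hl S = (GenSchur.prodSub l S₀).map (GenSchur.phi hl) ∧
      Nonempty (GenSchur.CR k S l ≃ₐ[k] MonoidAlgebra k (GenSchur.prodSub (p := p) l S₀)) ∧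
      Nonempty (GenSchur.CR k S l ≃ₐ[k]
        MonoidAlgebra k S₀ ⊗[k]
          (⨂[k] i : {i : ℕ // 0 < i ∧ 0 < GenSchur.mult p l i},
            MonoidAlgebra k (Equiv.Perm (Fin (GenSchur.mult p l i))))) := by
  open GenSchur in
  let Φ : MonoidAlgebra k (Sprime hl S) ≃ₐ[k] CR k S l := AlgEquiv.ofBijective
    (sprimeAlgHom k S hl) ⟨sprimeAlgHom_injective, sprimeAlgHom_surjective hn hS⟩
  have hS' : Sprime hl S = (prodSub l (baseSub hl S)).map (phi hl) := Sprime_eq_map hS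
  let e : prodSub l (baseSub hl S) ≃* Sprime hl S :=
    ((prodSub l (baseSub hl S)).equivMapOfInjective _ (phi_injective hl)).trans
      (MulEquiv.submonoidCongr hS'.symm)
  let Ψ : CR k S l ≃ₐ[k] MonoidAlgebra k (prodSub (p := p) l (baseSub hl S)) :=
    Φ.symm.trans (MonoidAlgebra.domCongr k k e.symm)
  have : Finite {i : ℕ // 0 < i ∧ 0 < mult p l i} :=
    (finite_mult_pos p l).subset fun _ h => h.2
  exact ⟨⟨Φ, sprimeAlgHom_apply⟩, baseSub hl S, rook_le_baseSub hS, hS', ⟨Ψ⟩,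
    ⟨((Ψ.trans (MonoidAlgebra.domCongr k k (prodEquiv l _).symm)).trans
      (prodAlgEquiv k _ _)).trans (Algebra.TensorProduct.congr AlgEquiv.refl (piAlgEquiv k _))⟩⟩

theorem proposition8p4 {r n p : ℕ} (hn : r ≤ n) [Fact p.Prime] (k : Type*) [Field k] [CharP k p]
    (S : GenSchur.TransMonoid r) (hS : GenSchur.rook r ≤ S.toSubmonoid)
    (l : GenSchur.Comp r n) (hl : GenSchur.IsPPartition p l) :
    (∃ Φ : MonoidAlgebra k (GenSchur.Sprime hl S) ≃ₐ[k] GenSchur.CR k S l,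
        ∀ x, Φ x = GenSchur.projR k S l (GenSchur.psi hl S k (GenSchur.inclS hl S k x))) ∧
    ∃ S₀ : Submonoid (GenSchur.PT (GenSchur.mult p l 0)),
      GenSchur.rook (GenSchur.mult p l 0) ≤ S₀ ∧
      GenSchur.Sprime hl S = (GenSchur.prodSub l S₀).map (GenSchur.phi hl) ∧
      Nonempty (GenSchur.CR k S l ≃ₐ[k] MonoidAlgebra k (GenSchur.prodSub (p := p) l S₀)) ∧
      Nonempty (GenSchur.CR k S l ≃ₐ[k]
        MonoidAlgebra k S₀ ⊗[k]
          (⨂[k] i : {i : ℕ // 0 < i ∧ 0 < GenSchur.mult p l i},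
            MonoidAlgebra k (Equiv.Perm (Fin (GenSchur.mult p l i))))) :=
  proposition8p4_general hn k S hS l hl
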